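/- **Setting.** Let $F,f:\mathbb R^n\times\mathbb R^m\to\mathbb R$, $H,G,h,g$ be mappings from $\mathbb R^n\times\mathbb R^m$ to $\mathbb R^p,\mathbb R^q,\mathbb R^r,\mathbb R^s$ respectively, and consider the bilevel problem of minimizing $F(x,y)$ subject to $H(x,y)=0$, $G(x,y)\le 0$ and $y$ solving the lower level problem $(P_x)$: $\min_y f(x,y)$ s.t. $h(x,y)=0$, $g(x,y)\le 0$. Put $\mathcal L(x;y,\mu,\xi)=f(x,y)+\mu^Th(x,y)+\xi^Tg(x,y)$ and $u=(x,y,\mu,\xi)$. The first-order reformulation is $$(FP)\quad \min_u F(x,y)\ \text{ s.t. } H(x,y)=0,\ G(x,y)\le0,\ \nabla_y\mathcal L(x;y,\mu,\xi)=0,\ h(x,y)=0,\ g(x,y)-\Pi_{\mathbb R^s_-}(g(x,y)+\xi)=0 .$$ All norms are Euclidean and $\Pi$ denotes projection. Let $\widetilde G(u)$ be the vector of the five constraint blocks of (FP) in this order, $\lambda=(\lambda_H,\lambda_G,\lambda_{\mathcal L},\lambda_h,\lambda_g)$, $K^\circ=\mathbb R^p\times\mathbb R^q_+\times\mathbb R^m\times\mathbb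 R^r\times\mathbb R^s$, $L^{FP}(u;\lambda)=F(x,y)+\lambda^T\widetilde G(u)$, and let $$L^{FP}_\rho(u;\lambda)=F(x,y)+\tfrac1{2\rho}\big(\|\max\{0,\lambda_G+\rho G(x,y)\}\|^2-\|\lambda_G\|^2\big)+\sum_{c}\big(\lambda_c^Tc(u)+\tfrac\rho2\|c(u)\|^2\big),$$ the sum running over the four equality blocks $c$ of (FP) with their multipliers $\lambda_c$. Let $$\sigma(u,\lambda)=\left\|\begin{pmatrix}\nabla_uL^{FP}(u;\lambda)\\ \lambda-\Pi_{K^\circ}(\lambda+\widetilde G(u))\end{pmatrix}\right\| .$$ Let $\Lambda(u)$ be the set of $\lambda$ with $\nabla_uL^{FP}(u;\lambda)=0$, $0\le\lambda_G\perp G(x,y)\le0$, and all equality constraints of (FP) satisfied at $u$. **Assumptions.** Let $u^*=(x^*,y^*,\mu^*,\xi^*)$. Around $(x^*,y^*)$ the functions $F,G,H,f,g,h$ are twice continuously differentiable, and so are, as functions of $(x,y)$, the partial gradients $\nabla_yf,\nabla_yg_i,\nabla_yh_j$. The Jacobian uniqueness conditions of $(P_{x^*})$ hold at $(y^*,\mu^*,\xi^*)$: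 $\nabla_y\mathcal L=0$, $h=0$, $0\le\xi^*\perp g\le0$; the vectors $\nabla_yh_j$ ($1\le j\le r$) and $\nabla_yg_i$ ($g_i(x^*,y^*)=0$) are linearly independent; $\xi_i^*-g_i(x^*,y^*)>0$ for all $i$; and $\langle\nabla^2_{yy}\mathcal L(x^*;y^*,\mu^*,\xi^*)d,d\rangle>0$ for every $d\ne0$ with $\nabla_yh_j^Td=0$ for all $j$, $\nabla_yg_i^Td\le0$ whenever $g_i(x^*,y^*)=0$, and $\nabla_yf^Td\le0$ (all at $(x^*,y^*)$). The pair $(u^*,\lambda^*)$ satisfies the SOSC of (FP): $\lambda^*\in\Lambda(u^*)$ and $d^T\nabla^2_{uu}L^{FP}(u^*;\lambda^*)d>0$ for every $d\neq0$ in the critical cone of (FP) at $u^*$, i.e. every nonzero $d=(d_x,d_y,d_\mu,d_\xi)$ for which the directional derivatives at $u^*$ along $d$ of all equality constraints of (FP) vanish, those of the $G_i$ with $G_i(x^*,y^*)=0$ are $\le0$, and that of $F$ is $\le0$. **Method.** Let $\psi:\mathbb R_+\to\mathbb R_+$ satisfy $\psi(t)/t\to0$ as $t\to0_+$, let $\hat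 c>0$ and $\rho_k>0$. From $(u^k,\lambda^k)$ with $\lambda^k\in K^\circ$, a step finds $u^{k+1}$ with $$\|\nabla_uL^{FP}_{\rho_k}(u^{k+1};\lambda^k)\|\le\epsilon_k:=\psi(\sigma(u^k,\lambda^k)),\qquad \left\|\begin{pmatrix}u^{k+1}-u^k\\ \Pi_{K^\circ}(\lambda^k+\rho_k\widetilde G(u^{k+1}))-\lambda^k\end{pmatrix}\right\|\le\hat c\,\sigma(u^k,\lambda^k),$$ and sets $\lambda^{k+1}=\Pi_{K^\circ}(\lambda^k+\rho_k\widetilde G(u^{k+1}))$. (If $\sigma(u^k,\lambda^k)=0$, the method has stopped; the step then just repeats $(u^k,\lambda^k)$.) **Theorem.** Given $\psi$, for every sufficiently large $\hat c$ there exist $\bar\epsilon,\bar\rho>0$ such that, whenever $\|(u^0,\lambda^0)-(u^*,\lambda^*)\|\le\bar\epsilon$, $\lambda^0\in K^\circ$ and $\rho_k\ge\bar\rho$ for all $k$: (i) the method is well defined (every finite run can be continued by a further step), and every sequence $\{(u^k,\lambda^k)\}$ that it generates converges to $(u^*,\bar\lambda)$ for some $\bar\lambda\in\Lambda(u^*)$;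 (ii) for every $t\in(0,1)$ there is $\bar\rho_t$, independent of the starting point and of the generated sequence, such that if moreover $\rho_k\ge\bar\rho_t$ for all $k$, then the convergence is Q-linear with quotient $t$: $\|(u^{k+1},\lambda^{k+1})-(u^*,\bar\lambda)\|\le t\,\|(u^k,\lambda^k)-(u^*,\bar\lambda)\|$ for all large $k$; (iii) if $\rho_k\to+\infty$, the convergence is Q-superlinear: $\|(u^{k+1},\lambda^{k+1})-(u^*,\bar\lambda)\|=o(\|(u^k,\lambda^k)-(u^*,\bar\lambda)\|)$. -/

import Mathlib

open Filter Topology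

noncomputable section

namespace Bilevel

/-- `ℝᵏ` with the Euclidean norm. -/
abbrev E (k : ℕ) : Type := EuclideanSpace ℝ (Fin k)

/-- The space of `u = (x, y, μ, ξ) ∈ ℝⁿ × ℝᵐ × ℝʳ × ℝˢ`, with the Euclidean norm. -/
abbrev Prim (n m r s : ℕ) : Type :=
  EuclideanSpace ℝ (Fin n ⊕ Fin m ⊕ Fin r ⊕ Fin s)

/-- The space of `lam = (λ_H, λ_G, λ_𝓛, λ_h, λ_g) ∈ ℝᵖ × ℝ^q × ℝᵐ × ℝʳ × ℝˢ`, with the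
Euclidean norm. -/
abbrev Dual (m p q r s : ℕ) : Type :=
  EuclideanSpace ℝ (Fin p ⊕ Fin q ⊕ Fin m ⊕ Fin r ⊕ Fin s)

/-- The pair `(u, lam)` as an element of the product space with the Euclidean norm
`‖(u, lam)‖ = √(‖u‖² + ‖lam‖²)`. -/
abbrev pair {A B : Type*} (a : A) (b : B) : WithLp 2 (A × B) := WithLp.toLp 2 (a, b)

section Coordinates

variable {n m p q r s : ℕ}

def xOf (u : Prim n m r s) : E n := WithLp.toLp 2 fun i => u (Sum.inl i)
def yOf (u : Prim n m r s) : E m := WithLp.toLp 2 fun i => u (Sum.inr (Sum.inl i))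
def muOf (u : Prim n m r s) : E r := WithLp.toLp 2 fun i => u (Sum.inr (Sum.inr (Sum.inl i)))
def xiOf (u : Prim n m r s) : E s := WithLp.toLp 2 fun i => u (Sum.inr (Sum.inr (Sum.inr i)))
def xyOf (u : Prim n m r s) : E n × E m := (xOf u, yOf u)

def lamH (lam : Dual m p q r s) : E p := WithLp.toLp 2 fun i => lam (Sum.inl i)
def lamG (lam : Dual m p q r s) : E q := WithLp.toLp 2 fun i => lam (Sum.inr (Sum.inl i))
def lamL (lam : Dual m p q r s) : E m :=
  WithLp.toLp 2 fun i => lam (Sum.inr (Sum.inr (Sum.inl i)))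
def lamh (lam : Dual m p q r s) : E r :=
  WithLp.toLp 2 fun i => lam (Sum.inr (Sum.inr (Sum.inr (Sum.inl i))))
def lamg (lam : Dual m p q r s) : E s :=
  WithLp.toLp 2 fun i => lam (Sum.inr (Sum.inr (Sum.inr (Sum.inr i))))

/-- The projection onto the nonpositive orthant `ℝ₋ᵏ`. -/
def projNonpos {k : ℕ} (w : E k) : E k := WithLp.toLp 2 fun i => min (w i) 0

/-- The componentwise maximum `max {0, w}`. -/
def posPart {k : ℕ} (w : E k) : E k := WithLp.toLp 2 fun i => max 0 (w i)

/-- The cone `K° = ℝᵖ × ℝ₊^q × ℝᵐ × ℝʳ × ℝˢ`. -/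
def polarCone (m p q r s : ℕ) : Set (Dual m p q r s) := {lam | ∀ i, 0 ≤ lamG lam i}

/-- The projection onto `K°`. -/
def projPolar (lam : Dual m p q r s) : Dual m p q r s :=
  WithLp.toLp 2 <| Sum.elim (fun i => lamH lam i) <| Sum.elim (fun i => max 0 (lamG lam i)) <|
    Sum.elim (fun i => lamL lam i) <| Sum.elim (fun i => lamh lam i) fun i => lamg lam i

/-- `projNonpos w` is a nearest point of `ℝ₋ᵏ` to `w`. -/
theorem projNonpos_spec {k : ℕ} (w : E k) :
    (∀ i, projNonpos w i ≤ 0) ∧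
      ∀ v : E k, (∀ i, v i ≤ 0) → ‖w - projNonpos w‖ ≤ ‖w - v‖ := by
  refine ⟨fun i => min_le_right _ _, fun v hv => ?_⟩
  rw [EuclideanSpace.norm_eq, EuclideanSpace.norm_eq]
  refine Real.sqrt_le_sqrt (Finset.sum_le_sum fun i _ => ?_)
  have h := hv i
  simp only [PiLp.sub_apply, Real.norm_eq_abs, sq_abs, projNonpos]
  rcases le_total (w i) 0 with h0 | h0
  · rw [min_eq_left h0]; nlinarith [sq_nonneg (w i - v i)]
  · rw [min_eq_right h0]; nlinarith

/-- `projPolar lam` is a nearest point of `K°` to `lam`. -/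
theorem projPolar_spec (lam : Dual m p q r s) :
    projPolar lam ∈ polarCone m p q r s ∧
      ∀ v ∈ polarCone m p q r s, ‖lam - projPolar lam‖ ≤ ‖lam - v‖ := by
  refine ⟨fun i => le_max_left _ _, fun v hv => ?_⟩
  rw [EuclideanSpace.norm_eq, EuclideanSpace.norm_eq]
  refine Real.sqrt_le_sqrt (Finset.sum_le_sum fun i _ => ?_)
  rcases i with i | i | i | i | i
  case inr.inl =>
    have h : 0 ≤ v (Sum.inr (Sum.inl i)) := hv i
    simp only [PiLp.sub_apply, Real.norm_eq_abs, sq_abs, projPolar, lamG, Sum.elim_inl,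
      Sum.elim_inr]
    rcases le_total 0 (lam (Sum.inr (Sum.inl i))) with h0 | h0
    · rw [max_eq_right h0]; nlinarith [sq_nonneg (lam (Sum.inr (Sum.inl i)) - v (Sum.inr (Sum.inl i)))]
    · rw [max_eq_left h0]; nlinarith
  all_goals simp [projPolar, lamH, lamL, lamh, lamg]; positivity

end Coordinates

/-- The quadratic form `d ↦ dᵀ ∇²φ(a) d` of the Hessian of `φ` at `a`. -/
def hessQuad {V : Type*} [NormedAddCommGroup V] [InnerProductSpace ℝ V] [CompleteSpace V]
    (φ : V → ℝ) (a d : V) : ℝ :=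
  inner ℝ (fderiv ℝ (gradient φ) a d) d

/-- The partial gradient `∇_y φ(x, y)`, where `z = (x, y)`. -/
def gradY {n m : ℕ} (φ : E n × E m → ℝ) (z : E n × E m) : E m :=
  gradient (fun y => φ (z.1, y)) z.2

/-- The data of the bilevel problem: minimize `F(x, y)` subject to `H(x, y) = 0`, `G(x, y) ≤ 0`
and `y` solving the lower level problem `(P_x)`: minimize `f(x, ·)` subject to `h(x, ·) = 0`,
`g(x, ·) ≤ 0`. -/
structure Problem (n m p q r s : ℕ) where
  F : E n × E m → ℝ
  H : E n × E m → E p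
  G : E n × E m → E q
  f : E n × E m → ℝ
  h : E n × E m → E r
  g : E n × E m → E s

namespace Problem

variable {n m p q r s : ℕ} (P : Problem n m p q r s)

/-- Around `z`, the functions `F, G, H, f, g, h` are twice continuously differentiable, and so are
the partial gradients in `y` of `f` and of the components of `g` and `h`. -/
def SmoothAround (z : E n × E m) : Prop :=
  ContDiffAt ℝ 2 P.F z ∧ ContDiffAt ℝ 2 P.H z ∧ ContDiffAt ℝ 2 P.G z ∧
  ContDiffAt ℝ 2 P.f z ∧ ContDiffAt ℝ 2 P.h z ∧ ContDiffAt ℝ 2 P.g z ∧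
  ContDiffAt ℝ 2 (gradY P.f) z ∧
  (∀ j, ContDiffAt ℝ 2 (gradY fun w => P.h w j) z) ∧
  (∀ i, ContDiffAt ℝ 2 (gradY fun w => P.g w i) z)

/-! ### The lower level problem -/

/-- The lower level Lagrangian `𝓛(x; y, μ, ξ) = f(x, y) + μᵀ h(x, y) + ξᵀ g(x, y)`. -/
def lowerLag (z : E n × E m) (mu : E r) (xi : E s) : ℝ :=
  P.f z + inner ℝ mu (P.h z) + inner ℝ xi (P.g z)

/-- `∇_y 𝓛(x; y, μ, ξ)`. -/
def gradLowerLag (z : E n × E m) (mu : E r) (xi : E s) : E m :=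
  gradY (fun w => P.lowerLag w mu xi) z

/-- `(y, μ, ξ)` is a KKT point of `(P_x)`. -/
def LowerKKT (z : E n × E m) (mu : E r) (xi : E s) : Prop :=
  P.gradLowerLag z mu xi = 0 ∧ P.h z = 0 ∧
  (∀ i, 0 ≤ xi i) ∧ (∀ i, P.g z i ≤ 0) ∧ inner ℝ xi (P.g z) = 0

/-- The linear independence constraint qualification for `(P_x)` at `y`. -/
def LowerLICQ (z : E n × E m) : Prop :=
  LinearIndependent ℝ
    (Sum.elim (fun j : Fin r => gradY (fun w => P.h w j) z)
      (fun i : {i : Fin s // P.g z i = 0} => gradY (fun w => P.g w i) z))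

/-- The critical cone of `(P_x)` at `y`. -/
def lowerCriticalCone (z : E n × E m) : Set (E m) :=
  {d | (∀ j, inner ℝ (gradY (fun w => P.h w j) z) d = 0) ∧
    (∀ i, P.g z i = 0 → inner ℝ (gradY (fun w => P.g w i) z) d ≤ 0) ∧
    inner ℝ (gradY P.f z) d ≤ 0}

/-- The Jacobian uniqueness conditions of `(P_x)` at `(y, μ, ξ)`: KKT, LICQ, strict
complementarity, second-order sufficiency. -/
def JacobianUniqueness (z : E n × E m) (mu : E r) (xi : E s) : Prop :=
  P.LowerKKT z mu xi ∧ P.LowerLICQ z ∧ (∀ i, 0 < xi i - P.g z i) ∧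
  ∀ d ∈ P.lowerCriticalCone z, d ≠ 0 →
    0 < hessQuad (fun y => P.lowerLag (z.1, y) mu xi) z.2 d

/-! ### The first-order reformulation (FP) -/

/-- `∇_y 𝓛` as a function of `u = (x, y, μ, ξ)`. -/
def stat (u : Prim n m r s) : E m := P.gradLowerLag (xyOf u) (muOf u) (xiOf u)

/-- `g(x, y) - Π_{ℝ₋ˢ}(g(x, y) + ξ)`. -/
def compl (u : Prim n m r s) : E s := P.g (xyOf u) - projNonpos (P.g (xyOf u) + xiOf u)

/-- The constraint mapping `G̃(u)` of (FP). -/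
def Gtilde (u : Prim n m r s) : Dual m p q r s :=
  WithLp.toLp 2 <| Sum.elim (fun i => P.H (xyOf u) i) <| Sum.elim (fun i => P.G (xyOf u) i) <|
    Sum.elim (fun i => P.stat u i) <| Sum.elim (fun i => P.h (xyOf u) i) fun i => P.compl u i

/-- The Lagrangian `L^{FP}(u; lam)`. -/
def lag (u : Prim n m r s) (lam : Dual m p q r s) : ℝ :=
  P.F (xyOf u) + inner ℝ (lamH lam) (P.H (xyOf u)) + inner ℝ (lamG lam) (P.G (xyOf u)) +
    inner ℝ (lamL lam) (P.stat u) + inner ℝ (lamh lam) (P.h (xyOf u)) +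
    inner ℝ (lamg lam) (P.compl u)

/-- `∇_u L^{FP}(u; lam)`. -/
def gradLag (u : Prim n m r s) (lam : Dual m p q r s) : Prim n m r s :=
  gradient (fun v => P.lag v lam) u

/-- The set `Λ(u)` of Lagrange multipliers of (FP) at `u`. -/
def multipliers (u : Prim n m r s) : Set (Dual m p q r s) :=
  {lam | P.gradLag u lam = 0 ∧ P.H (xyOf u) = 0 ∧
    ((∀ i, 0 ≤ lamG lam i) ∧ (∀ i, P.G (xyOf u) i ≤ 0) ∧
      inner ℝ (lamG lam) (P.G (xyOf u)) = 0) ∧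
    P.stat u = 0 ∧ P.h (xyOf u) = 0 ∧ P.compl u = 0}

/-- The critical cone of (FP) at `u`. -/
def criticalCone (u : Prim n m r s) : Set (Prim n m r s) :=
  {d | (∀ i, P.G (xyOf u) i = 0 → fderiv ℝ P.G (xyOf u) (xyOf d) i ≤ 0) ∧
    (fderiv ℝ P.H (xyOf u) (xyOf d) = 0 ∧ fderiv ℝ P.stat u d = 0 ∧
      fderiv ℝ P.h (xyOf u) (xyOf d) = 0 ∧ fderiv ℝ P.compl u d = 0) ∧
    fderiv ℝ P.F (xyOf u) (xyOf d) ≤ 0}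

/-- The second-order sufficient condition of (FP) at the pair `(u, lam)`. -/
def SOSC (u : Prim n m r s) (lam : Dual m p q r s) : Prop :=
  lam ∈ P.multipliers u ∧
    ∀ d ∈ P.criticalCone u, d ≠ 0 → 0 < hessQuad (fun v => P.lag v lam) u d

/-! ### The augmented Lagrangian method for (FP) -/

/-- The augmented Lagrangian `L_ρ^{FP}(u; lam)`. -/
def augLag (rho : ℝ) (u : Prim n m r s) (lam : Dual m p q r s) : ℝ :=
  P.F (xyOf u) +
    inner ℝ (lamH lam) (P.H (xyOf u)) + rho / 2 * ‖P.H (xyOf u)‖ ^ 2 +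
    1 / (2 * rho) * (‖posPart (lamG lam + rho • P.G (xyOf u))‖ ^ 2 - ‖lamG lam‖ ^ 2) +
    inner ℝ (lamL lam) (P.stat u) + rho / 2 * ‖P.stat u‖ ^ 2 +
    inner ℝ (lamh lam) (P.h (xyOf u)) + rho / 2 * ‖P.h (xyOf u)‖ ^ 2 +
    inner ℝ (lamg lam) (P.compl u) + rho / 2 * ‖P.compl u‖ ^ 2

/-- The natural residual `σ(u, lam)` of the KKT conditions of (FP). -/
def residual (u : Prim n m r s) (lam : Dual m p q r s) : ℝ :=
  ‖pair (P.gradLag u lam) (lam - projPolar (lam + P.Gtilde u))‖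

/-- One step from `(u, lam)` to `(u', lam')` with localization constant `c`, penalty parameter
`rho` and tolerance `eps`. (If the residual at `(u, lam)` vanishes, a step can only be
`(u', lam') = (u, lam)`: the method has stopped.) -/
def IsStep (c rho eps : ℝ) (u : Prim n m r s) (lam : Dual m p q r s)
    (u' : Prim n m r s) (lam' : Dual m p q r s) : Prop :=
  (DifferentiableAt ℝ (fun v => P.augLag rho v lam) u' ∧
    ‖gradient (fun v => P.augLag rho v lam) u'‖ ≤ eps) ∧
  ‖pair (u' - u) (projPolar (lam + rho • P.Gtilde u') - lam)‖ ≤ c * P.residual u lam ∧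
  lam' = projPolar (lam + rho • P.Gtilde u')

/-- The first `N` steps of the sequence `(uᵏ, lamᵏ)` are generated by the method with penalty
parameters `ρ_k` and tolerances `ε_k = ψ(σ(uᵏ, lamᵏ))`; `N = ⊤` means all steps. -/
def IsRun (N : ℕ∞) (psi : ℝ → ℝ) (c : ℝ) (rho : ℕ → ℝ) (u : ℕ → Prim n m r s)
    (lam : ℕ → Dual m p q r s) : Prop :=
  ∀ k : ℕ, (k : ℕ∞) < N →
    P.IsStep c (rho k) (psi (P.residual (u k) (lam k))) (u k) (lam k) (u (k + 1)) (lam (k + 1))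

end Problem

/-! ### Convergence rates -/

/-- `z` converges to `a` Q-linearly with quotient `t`. -/
def QLinear {V : Type*} [NormedAddCommGroup V] (z : ℕ → V) (a : V) (t : ℝ) : Prop :=
  Tendsto z atTop (𝓝 a) ∧ ∀ᶠ k in atTop, ‖z (k + 1) - a‖ ≤ t * ‖z k - a‖

/-- `z` converges to `a` Q-superlinearly: `‖z_{k+1} - a‖ = o(‖z_k - a‖)`. -/
def QSuperlinear {V : Type*} [NormedAddCommGroup V] (z : ℕ → V) (a : V) : Prop :=
  Tendsto z atTop (𝓝 a) ∧ (fun k => z (k + 1) - a) =o[atTop] fun k => z k - a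

end Bilevel

end

/-! ### General cone programs -/

noncomputable section

/-! Strict complementarity of the lower level makes each component of `compl` agree near `u*` with a
component of `g` or of `-ξ`. So (FP) is locally a twice smooth program with equalities and
inequalities, and the analysis concerns any such program at a point satisfying SOSC. No constraint
qualification is assumed for it: multipliers need not be unique, and the dual limit is not known in
advance. Three estimates carry the proof.

Error bound (`exists_error_bound`): near `(u*, λ*)`, for `λ` in the polar cone, the KKT residual
dominates both `‖u - u*‖` and the distance from `λ` to the multipliers. The dual part is Hoffman's
bound, the multiplier set being a polyhedron. For the primal part, normalised limits of a violating
family would give a nonzero critical direction `d` and a dual direction `η` for which the Hessian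
form at `d` plus `⟨η, con' d⟩` is zero while `⟨η, con' d⟩ ≥ 0`, contrary to SOSC.

Solvable subproblems (`exists_aug_stationary`): for large penalties the augmented Lagrangian grows
quadratically, uniformly in the multipliers near `λ*` (`exists_aug_growth`). It is also a maximum of
proximal Lagrangians over the polar cone (`aug_eq`, `le_aug`), which transfers growth from a nearby
multiplier to the current `λ`. Hence its minimiser on a small ball is interior, and the step to it
is of the order of the residual.

Residual decrease (`IsStep.residual_le`): the gradient of the augmented Lagrangian is that of the
Lagrangian at the updated multiplier, and the new complementarity residual is at most the dual
displacement over `ρ`. Therefore `σ⁺ ≤ ψ(σ) + ĉ σ / ρ`.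

For large `ρ` the residual halves in each step, so the step lengths are summable and the iterates
converge to a point of zero residual, which the error bound identifies. The remaining distance is at
most `2ĉσ` and `σ` is Lipschitz, so the quotient of successive distances is governed by `ψ(σ)/σ +
ĉ/ρ`; this gives both rates. -/

/-- The problem of minimizing `obj u` subject to `con u i ≤ 0` for `i ∈ ineq` and `con u i = 0`
for `i ∉ ineq`. -/
structure ConeProgram (V ι : Type*) where
  obj : V → ℝ
  con : V → EuclideanSpace ℝ ι
  ineq : Set ι

namespace ConeProgram

variable {V ι : Type*}

/-- The cone of multipliers which are nonnegative on the inequality constraints. -/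
def polar (A : ConeProgram V ι) : Set (EuclideanSpace ℝ ι) := {lam | ∀ i ∈ A.ineq, 0 ≤ lam i}

open Classical in
/-- The projection onto `A.polar`. -/
def proj (A : ConeProgram V ι) (lam : EuclideanSpace ℝ ι) : EuclideanSpace ℝ ι :=
  WithLp.toLp 2 fun i => if i ∈ A.ineq then max 0 (lam i) else lam i

open Classical in
/-- The augmented Lagrangian. -/
def aug [Fintype ι] (A : ConeProgram V ι) (rho : ℝ) (u : V) (lam : EuclideanSpace ℝ ι) : ℝ :=
  A.obj u + ∑ i, if i ∈ A.ineq then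
      ((max 0 (lam i + rho * A.con u i)) ^ 2 - lam i ^ 2) / (2 * rho)
    else lam i * A.con u i + rho / 2 * A.con u i ^ 2

/-- The Lagrangian. -/
def lagr [Fintype ι] (A : ConeProgram V ι) (u : V) (lam : EuclideanSpace ℝ ι) : ℝ :=
  A.obj u + inner ℝ lam (A.con u)

/-- Feasibility of `u`. -/
def Feasible (A : ConeProgram V ι) (u : V) : Prop :=
  (∀ i ∈ A.ineq, A.con u i ≤ 0) ∧ ∀ i ∉ A.ineq, A.con u i = 0

section Projection

variable (A : ConeProgram V ι)

theorem proj_apply_of_mem {i : ι} (hi : i ∈ A.ineq) (lam : EuclideanSpace ℝ ι) :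
    A.proj lam i = max 0 (lam i) := by simp [proj, hi]

theorem proj_apply_of_notMem {i : ι} (hi : i ∉ A.ineq) (lam : EuclideanSpace ℝ ι) :
    A.proj lam i = lam i := by simp [proj, hi]

theorem proj_mem (lam : EuclideanSpace ℝ ι) : A.proj lam ∈ A.polar := fun i hi => by
  rw [A.proj_apply_of_mem hi]; exact le_max_left _ _

theorem isClosed_polar : IsClosed A.polar := by
  have : A.polar = ⋂ i ∈ A.ineq, {lam : EuclideanSpace ℝ ι | 0 ≤ lam i} := by
    ext; simp [polar]
  rw [this]
  exact isClosed_biInter fun i _ => isClosed_le continuous_const (by fun_prop)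

variable [Fintype ι]

theorem norm_le_of_abs_le {x y : EuclideanSpace ℝ ι} (h : ∀ i, |x i| ≤ |y i|) : ‖x‖ ≤ ‖y‖ := by
  rw [EuclideanSpace.norm_eq, EuclideanSpace.norm_eq]
  refine Real.sqrt_le_sqrt (Finset.sum_le_sum fun i _ => ?_)
  simp only [Real.norm_eq_abs]
  exact pow_le_pow_left₀ (abs_nonneg _) (h i) 2

theorem norm_proj_sub_proj_le (a b : EuclideanSpace ℝ ι) : ‖A.proj a - A.proj b‖ ≤ ‖a - b‖ := by
  refine norm_le_of_abs_le fun i => ?_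
  by_cases hi : i ∈ A.ineq
  · simp only [PiLp.sub_apply, A.proj_apply_of_mem hi]
    have := abs_max_sub_max_le_abs (a i) (b i) 0
    rwa [max_comm (a i), max_comm (b i)] at this
  · simp [A.proj_apply_of_notMem hi]

/-- The complementarity residual after a multiplier update with penalty parameter `rho`. -/
theorem norm_proj_update_le {rho : ℝ} (hrho : 0 < rho) {lam : EuclideanSpace ℝ ι}
    (hlam : lam ∈ A.polar) (c : EuclideanSpace ℝ ι) :
    ‖A.proj (lam + rho • c) - A.proj (A.proj (lam + rho • c) + c)‖ ≤
      ‖A.proj (lam + rho • c) - lam‖ / rho := by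
  have h : ‖A.proj (lam + rho • c) - lam‖ / rho = ‖rho⁻¹ • (A.proj (lam + rho • c) - lam)‖ := by
    rw [norm_smul, Real.norm_of_nonneg (inv_nonneg.2 hrho.le)]; field_simp
  rw [h]
  refine norm_le_of_abs_le fun i => ?_
  simp only [PiLp.sub_apply, PiLp.smul_apply, smul_eq_mul]
  by_cases hi : i ∈ A.ineq
  · simp only [A.proj_apply_of_mem hi, PiLp.add_apply, PiLp.smul_apply, smul_eq_mul]
    have hl := hlam i hi
    -- Without truncation the scaled displacement is `c i`, and the residual is `|c i|` or, if the
    -- second projection truncates, `lam i + rho * c i ≤ -c i`. With truncation `c i ≤ 0` and the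
    -- residual is zero.
    rcases le_total 0 (lam i + rho * c i) with h1 | h1
    · rw [max_eq_right h1]
      have e : rho⁻¹ * (lam i + rho * c i - lam i) = c i := by field_simp; ring
      rw [e]
      rcases le_total 0 (lam i + rho * c i + c i) with h2 | h2
      · rw [max_eq_right h2]; simp
      · rw [max_eq_left h2, sub_zero, abs_of_nonneg h1, abs_of_nonpos (by linarith)]
        linarith
    · have hc : c i ≤ 0 := by
        by_contra hc
        push Not at hc
        nlinarith [mul_pos hrho hc]
      rw [max_eq_left h1, zero_add, max_eq_left hc, sub_zero, abs_zero]
      exact abs_nonneg _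
  · simp only [A.proj_apply_of_notMem hi, PiLp.add_apply, PiLp.smul_apply, smul_eq_mul]
    have e : rho⁻¹ * (lam i + rho * c i - lam i) = c i := by field_simp; ring
    rw [e]; simp

end Projection

/-! ### The augmented Lagrangian as a maximum of proximal Lagrangians -/

section AugmentedLagrangian

variable (A : ConeProgram V ι)

open Classical in
/-- The part of the augmented Lagrangian in excess of the Lagrangian, by constraints. -/
def excess (A : ConeProgram V ι) (rho : ℝ) (u : V) (lam : EuclideanSpace ℝ ι) (i : ι) : ℝ :=
  (if i ∈ A.ineq then ((max 0 (lam i + rho * A.con u i)) ^ 2 - lam i ^ 2) / (2 * rho)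
    else lam i * A.con u i + rho / 2 * A.con u i ^ 2) - lam i * A.con u i

theorem excess_of_notMem {i : ι} (hi : i ∉ A.ineq) (rho : ℝ) (u : V)
    (lam : EuclideanSpace ℝ ι) : A.excess rho u lam i = rho / 2 * A.con u i ^ 2 := by
  simp [excess, hi]

theorem excess_of_mem_of_nonneg {i : ι} (hi : i ∈ A.ineq) {rho : ℝ} (hrho : 0 < rho) {u : V}
    {lam : EuclideanSpace ℝ ι} (hlam : 0 ≤ lam i + rho * A.con u i) :
    A.excess rho u lam i = rho / 2 * A.con u i ^ 2 := by
  simp only [excess, hi, if_true, max_eq_right hlam]; field_simp; ring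

/-- On the truncated branch the excess is `lam i * (-con) - lam i ^ 2 / (2 * rho)`, and `lam i ≤ rho
* (-con)` lets half of the first term absorb the square. A truncated constraint with positive
multiplier thus costs to first order in `con`. -/
theorem le_excess_of_mem {i : ι} (hi : i ∈ A.ineq) {rho : ℝ} (hrho : 0 < rho) {u : V}
    {lam : EuclideanSpace ℝ ι} (hl : 0 ≤ lam i) (hlam : lam i + rho * A.con u i ≤ 0) :
    lam i * (-A.con u i) / 2 ≤ A.excess rho u lam i := by
  simp only [excess, hi, if_true, max_eq_left hlam]
  rw [le_sub_iff_add_le, le_div_iff₀ (by positivity)]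
  nlinarith [mul_nonneg hl (neg_nonneg.2 hlam)]

theorem excess_nonneg {rho : ℝ} (hrho : 0 < rho) (u : V) {lam : EuclideanSpace ℝ ι}
    (hl : lam ∈ A.polar) (i : ι) : 0 ≤ A.excess rho u lam i := by
  by_cases hi : i ∈ A.ineq
  · rcases le_total 0 (lam i + rho * A.con u i) with h1 | h1
    · rw [A.excess_of_mem_of_nonneg hi hrho h1]; positivity
    · refine le_trans ?_ (A.le_excess_of_mem hi hrho (hl i hi) h1)
      have : A.con u i ≤ 0 := by
        by_contra hc
        push Not at hc
        nlinarith [mul_pos hrho hc, hl i hi]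
      have := mul_nonneg (hl i hi) (neg_nonneg.2 this)
      linarith
  · rw [A.excess_of_notMem hi]; positivity

variable [Fintype ι]

theorem inner_eq_sum (a b : EuclideanSpace ℝ ι) : inner ℝ a b = ∑ i, a i * b i := by
  simp [PiLp.inner_apply, mul_comm]

theorem norm_sq_eq_sum (a : EuclideanSpace ℝ ι) : ‖a‖ ^ 2 = ∑ i, a i ^ 2 := by
  simp [EuclideanSpace.norm_sq_eq]

/-- The augmented Lagrangian is attained at the updated multiplier. -/
theorem aug_eq {rho : ℝ} (hrho : 0 < rho) (u : V) (lam : EuclideanSpace ℝ ι) :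
    A.aug rho u lam = A.lagr u (A.proj (lam + rho • A.con u)) -
      ‖A.proj (lam + rho • A.con u) - lam‖ ^ 2 / (2 * rho) := by
  rw [aug, lagr, inner_eq_sum, norm_sq_eq_sum, Finset.sum_div, add_sub_assoc,
    ← Finset.sum_sub_distrib]
  congr 1
  refine Finset.sum_congr rfl fun i _ => ?_
  by_cases hi : i ∈ A.ineq
  · simp only [hi, if_true, PiLp.sub_apply, A.proj_apply_of_mem hi, PiLp.add_apply,
      PiLp.smul_apply, smul_eq_mul]
    rcases le_total 0 (lam i + rho * A.con u i) with h1 | h1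
    · rw [max_eq_right h1]; field_simp; ring
    · rw [max_eq_left h1]; field_simp; ring
  · simp only [hi, if_false, PiLp.sub_apply, A.proj_apply_of_notMem hi, PiLp.add_apply,
      PiLp.smul_apply, smul_eq_mul]
    field_simp; ring

/-- The augmented Lagrangian dominates the proximal Lagrangian at every multiplier. -/
theorem le_aug {rho : ℝ} (hrho : 0 < rho) (u : V) (lam : EuclideanSpace ℝ ι)
    {nu : EuclideanSpace ℝ ι} (hnu : nu ∈ A.polar) :
    A.lagr u nu - ‖nu - lam‖ ^ 2 / (2 * rho) ≤ A.aug rho u lam := by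
  rw [aug, lagr, inner_eq_sum, norm_sq_eq_sum, Finset.sum_div, add_sub_assoc,
    ← Finset.sum_sub_distrib]
  refine add_le_add le_rfl (Finset.sum_le_sum fun i _ => ?_)
  -- Coordinatewise the left side is a concave quadratic in `nu i` with unconstrained maximiser `lam
  -- i + rho * con u i`. The squares supplied below are the gap; if the maximiser is negative, the
  -- sign of `nu i` does the rest.
  by_cases hi : i ∈ A.ineq
  · simp only [hi, if_true, PiLp.sub_apply]
    rw [sub_le_iff_le_add, ← add_div, le_div_iff₀ (by positivity)]
    have hn := hnu i hi
    rcases le_total 0 (lam i + rho * A.con u i) with h1 | h1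
    · rw [max_eq_right h1]; nlinarith [sq_nonneg (nu i - lam i - rho * A.con u i)]
    · rw [max_eq_left h1]; nlinarith [mul_nonneg hn (neg_nonneg.2 h1), sq_nonneg (nu i)]
  · simp only [hi, if_false, PiLp.sub_apply]
    rw [sub_le_iff_le_add, ← sub_le_iff_le_add', le_div_iff₀ (by positivity)]
    nlinarith [sq_nonneg (nu i - lam i - rho * A.con u i)]

/-- In `aug_eq` the subtracted square only lowers the value, and at a feasible point so does the
pairing of the constraints with a multiplier of the right sign. -/
theorem aug_le_obj {rho : ℝ} (hrho : 0 < rho) {u : V} (hu : A.Feasible u)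
    (lam : EuclideanSpace ℝ ι) : A.aug rho u lam ≤ A.obj u := by
  rw [A.aug_eq hrho, lagr, inner_eq_sum]
  have h : ∑ i, A.proj (lam + rho • A.con u) i * A.con u i ≤ 0 := by
    refine Finset.sum_nonpos fun i _ => ?_
    by_cases hi : i ∈ A.ineq
    · exact mul_nonpos_of_nonneg_of_nonpos (A.proj_mem _ i hi) (hu.1 i hi)
    · rw [hu.2 i hi, mul_zero]
  have : 0 ≤ ‖A.proj (lam + rho • A.con u) - lam‖ ^ 2 / (2 * rho) := by positivity
  linarith

theorem aug_eq_lagr_add (rho : ℝ) (u : V) (lam : EuclideanSpace ℝ ι) :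
    A.aug rho u lam = A.lagr u lam + ∑ i, A.excess rho u lam i := by
  simp only [aug, lagr, inner_eq_sum, excess, Finset.sum_sub_distrib]; ring

end AugmentedLagrangian

/-! ### Derivatives of the Lagrangians -/

section Derivatives

variable [Fintype ι] [NormedAddCommGroup V] [InnerProductSpace ℝ V] (A : ConeProgram V ι)

/-- The derivative of the Lagrangian with respect to the primal variable. -/
def dLag (z : V × EuclideanSpace ℝ ι) : V →L[ℝ] ℝ :=
  fderiv ℝ A.obj z.1 + (innerSL ℝ z.2) ∘L fderiv ℝ A.con z.1

theorem dLag_apply (u : V) (lam : EuclideanSpace ℝ ι) (d : V) :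
    A.dLag (u, lam) d = fderiv ℝ A.obj u d + inner ℝ lam (fderiv ℝ A.con u d) := rfl

theorem hasFDerivAt_lagr {u : V} (ho : DifferentiableAt ℝ A.obj u)
    (hc : DifferentiableAt ℝ A.con u) (lam : EuclideanSpace ℝ ι) :
    HasFDerivAt (fun v => A.lagr v lam) (A.dLag (u, lam)) u :=
  ho.hasFDerivAt.add ((innerSL ℝ lam).hasFDerivAt.comp u hc.hasFDerivAt)

/-- Squaring removes the kink: at zero the function is bounded by `x ^ 2`. -/
theorem hasDerivAt_max_zero_sq (a : ℝ) :
    HasDerivAt (fun x : ℝ => (max 0 x) ^ 2) (2 * max 0 a) a := by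
  rcases lt_trichotomy a 0 with h | h | h
  · rw [max_eq_left h.le, mul_zero]
    refine (hasDerivAt_const a (0 : ℝ)).congr_of_eventuallyEq ?_
    filter_upwards [eventually_lt_nhds h] with x hx
    simp [max_eq_left hx.le]
  · subst h
    rw [hasDerivAt_iff_isLittleO]
    refine Asymptotics.IsBigO.trans_isLittleO (g := fun x : ℝ => (x - 0) ^ 2) ?_ ?_
    · refine Asymptotics.IsBigO.of_bound 1 (Eventually.of_forall fun x => ?_)
      rcases le_total 0 x with h | h <;> simp [h, sq_nonneg]
    · simpa using Asymptotics.isLittleO_pow_id (𝕜 := ℝ) (n := 2) (by norm_num)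
  · rw [max_eq_right h.le]
    have := (hasDerivAt_id a).pow 2
    simp only [id, Nat.cast_ofNat, Nat.add_one_sub_one, pow_one, mul_one] at this
    refine this.congr_of_eventuallyEq ?_
    filter_upwards [eventually_gt_nhds h] with x hx
    simp [max_eq_right hx.le]

/-- Differentiating each penalty term yields the updated multiplier times the derivative of the
constraint. Approximate stationarity of a subproblem is therefore approximate stationarity of the
Lagrangian at the next multiplier, with the same tolerance. -/
theorem hasFDerivAt_aug {rho : ℝ} (hrho : 0 < rho) {u : V} (ho : DifferentiableAt ℝ A.obj u)
    (hc : DifferentiableAt ℝ A.con u) (lam : EuclideanSpace ℝ ι) :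
    HasFDerivAt (fun v => A.aug rho v lam) (A.dLag (u, A.proj (lam + rho • A.con u))) u := by
  have hci : ∀ i, HasFDerivAt (fun v => A.con v i)
      (EuclideanSpace.proj i ∘L fderiv ℝ A.con u : V →L[ℝ] ℝ) u := fun i =>
    (EuclideanSpace.proj (𝕜 := ℝ) i : EuclideanSpace ℝ ι →L[ℝ] ℝ).hasFDerivAt.comp u hc.hasFDerivAt
  have e : A.dLag (u, A.proj (lam + rho • A.con u)) = fderiv ℝ A.obj u +
      ∑ i, A.proj (lam + rho • A.con u) i • (EuclideanSpace.proj i ∘L fderiv ℝ A.con u) := by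
    ext d
    simp [dLag_apply, inner_eq_sum]
  rw [e]
  refine ho.hasFDerivAt.add (HasFDerivAt.fun_sum fun i _ => ?_)
  by_cases hi : i ∈ A.ineq
  · simp only [hi, if_true, A.proj_apply_of_mem hi]
    have h1 := (hasDerivAt_max_zero_sq (lam i + rho * A.con u i)).comp_hasFDerivAt u
      (((hci i).const_mul rho).const_add (lam i))
    have h2 := (h1.sub_const (lam i ^ 2)).mul_const (2 * rho)⁻¹
    refine h2.congr_fderiv ?_
    ext d
    simp
    field_simp
  · simp only [hi, if_false, A.proj_apply_of_notMem hi]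
    refine (((hci i).const_mul (lam i)).add (((hci i).pow 2).const_mul (rho / 2))).congr_fderiv ?_
    ext d
    simp
    ring

end Derivatives

end ConeProgram

/-! ### Contradiction along ultrafilters, and Hoffman's bound -/

/-- This replaces the extraction of subsequences: along an ultrafilter bounded families converge,
and one of finitely many alternatives holds eventually. In its uses the constant sought is an
additional variable tending to `0` from above. -/
theorem eventually_of_ultrafilter {α : Type*} {L : Filter α} {p : α → Prop}
    (h : ∀ U : Ultrafilter α, ↑U ≤ L → (∀ᶠ x in (U : Filter α), ¬p x) → False) :
    ∀ᶠ x in L, p x := by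
  refine Filter.mem_iff_ultrafilter.2 fun U hU => ?_
  by_contra hp
  exact h U hU (Ultrafilter.eventually_not.2 hp)

theorem Ultrafilter.exists_tendsto_of_norm_le {α E : Type*} [NormedAddCommGroup E] [ProperSpace E]
    (U : Ultrafilter α) {f : α → E} {C : ℝ} (h : ∀ᶠ x in (U : Filter α), ‖f x‖ ≤ C) :
    ∃ a, Tendsto f U (𝓝 a) := by
  obtain ⟨a, -, ha⟩ := (isCompact_closedBall (0 : E) C).ultrafilter_le_nhds (U.map f)
    (by
      rw [le_principal_iff]
      change ∀ᶠ x in (U : Filter α), f x ∈ Metric.closedBall 0 C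
      filter_upwards [h] with x hx
      simpa using hx)
  exact ⟨a, ha⟩

/-- Hoffman's error bound for the system `T x = b`, `x j ≥ 0` for `j ∈ J`, at points which satisfy
the inequalities. -/
theorem exists_hoffman_bound {ι X : Type*} [Fintype ι] [NormedAddCommGroup X] [NormedSpace ℝ X]
    (T : EuclideanSpace ℝ ι →L[ℝ] X) (b : X) (J : Set ι)
    (hne : ∃ x : EuclideanSpace ℝ ι, (∀ j ∈ J, 0 ≤ x j) ∧ T x = b) :
    ∃ C > 0, ∀ x : EuclideanSpace ℝ ι, (∀ j ∈ J, 0 ≤ x j) →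
      ∃ y : EuclideanSpace ℝ ι, ((∀ j ∈ J, 0 ≤ y j) ∧ T y = b) ∧
        (∀ z : EuclideanSpace ℝ ι, (∀ j ∈ J, 0 ≤ z j) → T z = b → ‖x - y‖ ≤ ‖x - z‖) ∧
        ‖x - y‖ ≤ C * ‖T x - b‖ := by
  set Q : Set (EuclideanSpace ℝ ι) := {x | ∀ j ∈ J, 0 ≤ x j} with hQ
  set S : Set (EuclideanSpace ℝ ι) := {x | (∀ j ∈ J, 0 ≤ x j) ∧ T x = b} with hS
  have hclosed : IsClosed S := by
    have : S = (⋂ j ∈ J, {x : EuclideanSpace ℝ ι | 0 ≤ x j}) ∩ T ⁻¹' {b} := by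
      ext; simp [hS]
    rw [this]
    exact (isClosed_biInter fun i _ => isClosed_le continuous_const (by fun_prop)).inter
      (isClosed_singleton.preimage T.continuous)
  have hconv : Convex ℝ S := by
    rintro x ⟨hx, hx'⟩ y ⟨hy, hy'⟩ s t hs ht hst
    refine ⟨fun j hj => ?_, ?_⟩
    · simpa using add_nonneg (mul_nonneg hs (hx j hj)) (mul_nonneg ht (hy j hj))
    · rw [map_add, map_smul, map_smul, hx', hy', ← add_smul, hst, one_smul]
  choose y hyS hy using fun x => exists_norm_eq_iInf_of_complete_convex hne hclosed.isComplete
    hconv x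
  have hmin : ∀ x, ∀ z ∈ S, ‖x - y x‖ ≤ ‖x - z‖ := fun x z hz => by
    rw [hy x]
    exact ciInf_le (f := fun w : S => ‖x - w‖)
      ⟨0, by rintro _ ⟨w, rfl⟩; exact norm_nonneg _⟩ ⟨z, hz⟩
  have hvar : ∀ x, ∀ z ∈ S, inner ℝ (x - y x) (z - y x) ≤ 0 := fun x =>
    (norm_eq_iInf_iff_real_inner_le_zero hconv (hyS x)).1 (hy x)
  have key : ∀ᶠ p : ℝ × EuclideanSpace ℝ ι in 𝓝[>] 0 ×ˢ 𝓟 Q,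
      p.1 * ‖p.2 - y p.2‖ ≤ ‖T p.2 - b‖ := by
    refine eventually_of_ultrafilter fun U hU hneg => ?_
    have hQ' : ∀ᶠ p in (U : Filter (ℝ × EuclideanSpace ℝ ι)), p.2 ∈ Q :=
      (tendsto_snd.mono_left hU).eventually (mem_principal_self Q)
    have heps : Tendsto (fun p : ℝ × EuclideanSpace ℝ ι => p.1) U (𝓝 0) :=
      (tendsto_fst.mono_left hU).mono_right nhdsWithin_le_nhds
    let w : ℝ × EuclideanSpace ℝ ι → EuclideanSpace ℝ ι := fun p =>
      ‖p.2 - y p.2‖⁻¹ • (p.2 - y p.2)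
    have hpos : ∀ᶠ p in (U : Filter (ℝ × EuclideanSpace ℝ ι)), 0 < ‖p.2 - y p.2‖ := by
      filter_upwards [hneg] with p hp
      refine lt_of_le_of_ne (norm_nonneg _) fun h => hp ?_
      rw [← h, mul_zero]; exact norm_nonneg _
    have hw1 : ∀ᶠ p in (U : Filter (ℝ × EuclideanSpace ℝ ι)), ‖w p‖ = 1 := by
      filter_upwards [hpos] with p hp
      simp only [w, norm_smul, norm_inv, norm_norm]
      exact inv_mul_cancel₀ hp.ne'
    obtain ⟨ω, hω⟩ := U.exists_tendsto_of_norm_le (hw1.mono fun _ h => h.le)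
    have hω1 : ‖ω‖ = 1 := tendsto_nhds_unique hω.norm
      ((tendsto_congr' hw1).2 tendsto_const_nhds)
    have hTω : T ω = 0 := by
      refine tendsto_nhds_unique ((T.continuous.tendsto ω).comp hω)
        (squeeze_zero_norm' ?_ heps)
      filter_upwards [hneg, hpos] with p hp h0
      have e : T (w p) = ‖p.2 - y p.2‖⁻¹ • (T p.2 - b) := by
        simp only [w, map_smul, map_sub, (hyS p.2).2]
      rw [Function.comp_apply, e, norm_smul, norm_inv, norm_norm, inv_mul_le_iff₀ h0, mul_comm]
      exact (not_le.1 hp).le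
    -- Where the projection has a zero coordinate, `p.2 - y p.2` is nonnegative. Either this
    -- coordinate is eventually zero and the sign passes to `ω`, or it is eventually nonzero and the
    -- claim is void.
    have hsign : ∀ j ∈ J, ∀ᶠ p in (U : Filter (ℝ × EuclideanSpace ℝ ι)), y p.2 j = 0 → 0 ≤ ω j := by
      intro j hj
      by_cases hz : ∀ᶠ p in (U : Filter (ℝ × EuclideanSpace ℝ ι)), y p.2 j = 0
      · refine Eventually.of_forall fun _ _ => ?_
        refine ge_of_tendsto (((continuous_apply j).comp
          (PiLp.continuous_ofLp 2 _)).continuousAt.tendsto.comp hω) ?_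
        filter_upwards [hz, hQ'] with p hp hq
        simp only [Function.comp_apply, w, PiLp.smul_apply, PiLp.sub_apply, hp, sub_zero,
          smul_eq_mul]
        exact mul_nonneg (inv_nonneg.2 (norm_nonneg _)) (hq j hj)
      · filter_upwards [Ultrafilter.eventually_not.2 hz] with p hp h
        exact absurd h hp
    have hsign' : ∀ᶠ p in (U : Filter (ℝ × EuclideanSpace ℝ ι)), ∀ j ∈ J, y p.2 j = 0 → 0 ≤ ω j :=
      eventually_all.2 fun j => by
        by_cases hj : j ∈ J
        · exact (hsign j hj).mono fun _ h _ => h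
        · exact Eventually.of_forall fun _ h => absurd h hj
    have hinner : ∀ᶠ p in (U : Filter (ℝ × EuclideanSpace ℝ ι)), 0 < inner ℝ (w p) ω := by
      have : Tendsto (fun p => inner ℝ (w p) ω) U (𝓝 (inner ℝ ω ω)) := hω.inner tendsto_const_nhds
      refine this.eventually (lt_mem_nhds ?_)
      rw [real_inner_self_eq_norm_sq, hω1]; norm_num
    obtain ⟨p, hp0, hps, hpi⟩ := (hpos.and (hsign'.and hinner)).exists
    -- A short move from the projection along `ω` stays in `S`. As `ω` makes a positive inner
    -- product with the direction towards `p.2`, this violates the variational inequality of the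
    -- projection.
    have hstep : ∀ᶠ e in 𝓝[>] (0 : ℝ), y p.2 + e • ω ∈ S := by
      have h1 : ∀ j ∈ J, ∀ᶠ e in 𝓝[>] (0 : ℝ), 0 ≤ (y p.2 + e • ω) j := by
        intro j hj
        rcases eq_or_lt_of_le ((hyS p.2).1 j hj) with h | h
        · filter_upwards [self_mem_nhdsWithin] with e he
          simp only [PiLp.add_apply, PiLp.smul_apply, smul_eq_mul, ← h, zero_add]
          exact mul_nonneg (le_of_lt he) (hps j hj h.symm)
        · have : Tendsto (fun e : ℝ => (y p.2 + e • ω) j) (𝓝[>] 0) (𝓝 (y p.2 j)) := by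
            have : Continuous fun e : ℝ => (y p.2 + e • ω) j := by fun_prop
            simpa using (this.tendsto 0).mono_left nhdsWithin_le_nhds
          exact (this.eventually (lt_mem_nhds h)).mono fun _ h => h.le
      have h2 : ∀ᶠ e in 𝓝[>] (0 : ℝ), ∀ j ∈ J, 0 ≤ (y p.2 + e • ω) j :=
        eventually_all.2 fun j => by
          by_cases hj : j ∈ J
          · exact (h1 j hj).mono fun _ h _ => h
          · exact Eventually.of_forall fun _ h => absurd h hj
      filter_upwards [h2] with e he
      exact ⟨he, by rw [map_add, map_smul, hTω, smul_zero, add_zero, (hyS p.2).2]⟩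
    obtain ⟨e, heS, he0⟩ := (hstep.and self_mem_nhdsWithin).exists
    have h3 := hvar p.2 _ heS
    have h4 : p.2 - y p.2 = ‖p.2 - y p.2‖ • w p := by
      simp only [w, smul_smul, mul_inv_cancel₀ hp0.ne', one_smul]
    rw [add_sub_cancel_left, h4, inner_smul_left, inner_smul_right] at h3
    have : 0 < ‖p.2 - y p.2‖ * (e * inner ℝ (w p) ω) := mul_pos hp0 (mul_pos he0 hpi)
    simp only [conj_trivial] at h3
    linarith
  -- Currying separates the constant from the points: a single small `ε` serves all of `Q`.
  obtain ⟨ε, hε, hε0⟩ := (key.curry.and self_mem_nhdsWithin).exists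
  rw [eventually_principal] at hε
  have hε0 : 0 < ε := hε0
  refine ⟨ε⁻¹, inv_pos.2 hε0, fun x hx => ⟨y x, hyS x, fun z hz hz' => hmin x z ⟨hz, hz'⟩, ?_⟩⟩
  rw [← div_eq_inv_mul, le_div_iff₀ hε0, mul_comm]
  exact hε x hx

/-! ### The second-order condition and the distance to the multipliers -/

namespace ConeProgram

variable {V ι : Type*} [Fintype ι] [NormedAddCommGroup V] [InnerProductSpace ℝ V]

/-- The multipliers associated with a feasible point `u`. -/
def multipliers (A : ConeProgram V ι) (u : V) : Set (EuclideanSpace ℝ ι) :=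
  {lam | A.dLag (u, lam) = 0 ∧ ∀ i ∈ A.ineq, 0 ≤ lam i ∧ lam i * A.con u i = 0}

/-- The natural residual of the KKT conditions. -/
def res (A : ConeProgram V ι) (u : V) (lam : EuclideanSpace ℝ ι) : ℝ :=
  ‖A.dLag (u, lam)‖ + ‖lam - A.proj (lam + A.con u)‖

/-- The second-order sufficient optimality condition, with the smoothness of the data. -/
structure SOSC (A : ConeProgram V ι) (u : V) (lam : EuclideanSpace ℝ ι) : Prop where
  obj_smooth : ContDiffAt ℝ 2 A.obj u
  con_smooth : ContDiffAt ℝ 2 A.con u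
  feasible : A.Feasible u
  mem : lam ∈ A.multipliers u
  pos : ∀ d ≠ 0, (∀ i ∉ A.ineq, fderiv ℝ A.con u d i = 0) →
    (∀ i ∈ A.ineq, A.con u i = 0 → fderiv ℝ A.con u d i ≤ 0) → fderiv ℝ A.obj u d ≤ 0 →
    0 < fderiv ℝ A.dLag (u, lam) (d, 0) d

variable {A : ConeProgram V ι} {u : V} {lam : EuclideanSpace ℝ ι}

theorem res_nonneg (A : ConeProgram V ι) (u : V) (lam : EuclideanSpace ℝ ι) : 0 ≤ A.res u lam := by
  unfold res; positivity

theorem mem_polar_of_mem_multipliers (h : lam ∈ A.multipliers u) : lam ∈ A.polar :=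
  fun i hi => (h.2 i hi).1

theorem Feasible.lagr_eq_obj (hu : A.Feasible u) (h : lam ∈ A.multipliers u) :
    A.lagr u lam = A.obj u := by
  rw [lagr, inner_eq_sum, Finset.sum_eq_zero, add_zero]
  intro i _
  by_cases hi : i ∈ A.ineq
  · exact (h.2 i hi).2
  · rw [hu.2 i hi, mul_zero]

theorem Feasible.proj_add_con (hu : A.Feasible u) (h : lam ∈ A.multipliers u) :
    A.proj (lam + A.con u) = lam := by
  ext i
  by_cases hi : i ∈ A.ineq
  · obtain ⟨h1, h2⟩ := h.2 i hi
    rw [A.proj_apply_of_mem hi, PiLp.add_apply]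
    rcases mul_eq_zero.1 h2 with h3 | h3
    · rw [h3, zero_add, max_eq_left (hu.1 i hi)]
    · rw [h3, add_zero, max_eq_right h1]
  · rw [A.proj_apply_of_notMem hi, PiLp.add_apply, hu.2 i hi, add_zero]

theorem contDiffAt_dLag (ho : ContDiffAt ℝ 2 A.obj u) (hc : ContDiffAt ℝ 2 A.con u)
    (lam : EuclideanSpace ℝ ι) : ContDiffAt ℝ 1 A.dLag (u, lam) := by
  have h1 : ContDiffAt ℝ 1 (fun z : V × EuclideanSpace ℝ ι => fderiv ℝ A.obj z.1) (u, lam) :=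
    (ho.fderiv_right (m := 1) (by norm_num)).comp (u, lam) contDiffAt_fst
  have h2 : ContDiffAt ℝ 1 (fun z : V × EuclideanSpace ℝ ι => fderiv ℝ A.con z.1) (u, lam) :=
    (hc.fderiv_right (m := 1) (by norm_num)).comp (u, lam) contDiffAt_fst
  have h3 : ContDiffAt ℝ 1 (fun z : V × EuclideanSpace ℝ ι => innerSL ℝ z.2) (u, lam) :=
    (ContinuousLinearMap.contDiff (innerSL ℝ)).contDiffAt.comp (u, lam) contDiffAt_snd
  exact h1.add (h3.clm_comp h2)

theorem eventually_differentiableAt (ho : ContDiffAt ℝ 2 A.obj u) (hc : ContDiffAt ℝ 2 A.con u) :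
    ∀ᶠ v in 𝓝 u, DifferentiableAt ℝ A.obj v ∧ DifferentiableAt ℝ A.con v := by
  filter_upwards [ho.eventually (by simp), hc.eventually (by simp)] with v h1 h2
  exact ⟨h1.differentiableAt (by norm_num), h2.differentiableAt (by norm_num)⟩

namespace SOSC

/-- Strictness lets both ends of a difference move: `(v, lam)` will be compared with `(u, nu)` for a
varying multiplier `nu`. -/
theorem hasStrictFDerivAt_dLag (h : A.SOSC u lam) :
    HasStrictFDerivAt A.dLag (fderiv ℝ A.dLag (u, lam)) (u, lam) :=
  (contDiffAt_dLag h.obj_smooth h.con_smooth lam).hasStrictFDerivAt (by norm_num)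

theorem fderiv_dLag_snd (h : A.SOSC u lam) (eta : EuclideanSpace ℝ ι) (d : V) :
    fderiv ℝ A.dLag (u, lam) (0, eta) d = inner ℝ eta (fderiv ℝ A.con u d) := by
  have h1 : HasDerivAt (fun s : ℝ => A.dLag (u, lam + s • eta)) (fderiv ℝ A.dLag (u, lam) (0, eta))
      0 := by
    have hg : HasDerivAt (fun s : ℝ => (u, lam + s • eta)) ((0 : V), eta) 0 := by
      refine (hasDerivAt_const _ _).prodMk ?_
      simpa using ((hasDerivAt_id (0 : ℝ)).smul_const eta).const_add lam
    have hf : HasFDerivAt A.dLag (fderiv ℝ A.dLag (u, lam)) (u, lam + (0 : ℝ) • eta) := by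
      rw [zero_smul, add_zero]; exact h.hasStrictFDerivAt_dLag.hasFDerivAt
    exact hf.comp_hasDerivAt (0 : ℝ) hg
  have h2 : HasDerivAt (fun s : ℝ => A.dLag (u, lam + s • eta))
      ((innerSL ℝ eta) ∘L fderiv ℝ A.con u) 0 := by
    have e : (fun s : ℝ => A.dLag (u, lam + s • eta)) = fun s : ℝ =>
        A.dLag (u, lam) + s • ((innerSL ℝ eta) ∘L fderiv ℝ A.con u) := by
      ext s d
      simp [dLag_apply, inner_add_left, inner_smul_left]
      ring
    rw [e]
    simpa using ((hasDerivAt_id (0 : ℝ)).smul_const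
      ((innerSL ℝ eta) ∘L fderiv ℝ A.con u)).const_add (A.dLag (u, lam))
  rw [h1.unique h2]
  simp

/-- By stationarity the derivative of the objective along `d` is `-⟨lam, con' d⟩`, which vanishes
once the strongly active constraints have zero derivative. The limit arguments below produce
directions in this form. -/
theorem pos_of_strong (h : A.SOSC u lam) {d : V} (hd : d ≠ 0)
    (h1 : ∀ i ∉ A.ineq, fderiv ℝ A.con u d i = 0)
    (h2 : ∀ i ∈ A.ineq, A.con u i = 0 → fderiv ℝ A.con u d i ≤ 0)
    (h3 : ∀ i ∈ A.ineq, A.con u i = 0 → 0 < lam i → fderiv ℝ A.con u d i = 0) :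
    0 < fderiv ℝ A.dLag (u, lam) (d, 0) d := by
  refine h.pos d hd h1 h2 (le_of_eq ?_)
  have h4 : A.dLag (u, lam) d = 0 := by rw [h.mem.1]; rfl
  rw [dLag_apply, inner_eq_sum, Finset.sum_eq_zero, add_zero] at h4
  · exact h4
  intro i _
  by_cases hi : i ∈ A.ineq
  · obtain ⟨h5, h6⟩ := h.mem.2 i hi
    rcases eq_or_lt_of_le h5 with h5 | h5
    · rw [← h5, zero_mul]
    · rw [h3 i hi ((mul_eq_zero.1 h6).resolve_left h5.ne') h5, mul_zero]
  · rw [h1 i hi, mul_zero]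

/-- The distance of `nu` to the set of multipliers, by Hoffman's bound. -/
theorem exists_dist_multipliers_le (h : A.SOSC u lam) :
    ∃ C > 0, ∀ᶠ z : V × EuclideanSpace ℝ ι in 𝓝 u ×ˢ 𝓝[A.polar] lam,
      ∃ nu ∈ A.multipliers u, ‖z.2 - nu‖ ≤ ‖z.2 - lam‖ ∧
        ‖z.2 - nu‖ ≤ C * (A.res z.1 z.2 + ‖z.1 - u‖) := by
  classical
  -- `T₂` keeps the coordinates of the inactive inequalities and `T₁` is the multiplier part of
  -- stationarity. The multipliers become the solutions of a linear system with sign constraints.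
  let T₂ : EuclideanSpace ℝ ι →L[ℝ] EuclideanSpace ℝ ι :=
    LinearMap.toContinuousLinearMap
      { toFun := fun nu => WithLp.toLp 2 fun i => if i ∈ A.ineq ∧ A.con u i ≠ 0 then nu i else 0
        map_add' := fun a b => by ext i; simp only [PiLp.add_apply]; split_ifs <;> simp
        map_smul' := fun a b => by ext i; simp }
  let T₁ : EuclideanSpace ℝ ι →L[ℝ] (V →L[ℝ] ℝ) :=
    (fderiv ℝ A.dLag (u, lam)).comp (ContinuousLinearMap.inr ℝ V (EuclideanSpace ℝ ι))
  have hT₂ : ∀ nu i, T₂ nu i = if i ∈ A.ineq ∧ A.con u i ≠ 0 then nu i else 0 := fun _ _ => rfl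
  have hT₁ : ∀ nu, A.dLag (u, nu) = fderiv ℝ A.obj u + T₁ nu := fun nu => by
    ext d
    simp only [dLag_apply, add_apply, T₁, ContinuousLinearMap.comp_apply,
      ContinuousLinearMap.inr_apply, h.fderiv_dLag_snd]
  have hS : ∀ nu : EuclideanSpace ℝ ι, ((∀ j ∈ A.ineq, 0 ≤ nu j) ∧
      (T₁.prod T₂) nu = (-fderiv ℝ A.obj u, 0)) ↔ nu ∈ A.multipliers u := by
    intro nu
    rw [ContinuousLinearMap.prod_apply, Prod.mk.injEq, multipliers, Set.mem_ofPred_eq, hT₁,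
      add_comm, ← eq_neg_iff_add_eq_zero]
    constructor
    · rintro ⟨h1, h2, h3⟩
      refine ⟨h2, fun i hi => ⟨h1 i hi, ?_⟩⟩
      have h4 : T₂ nu i = 0 := by rw [h3]; rfl
      rw [hT₂] at h4
      by_cases hc : A.con u i = 0
      · rw [hc, mul_zero]
      · rw [if_pos ⟨hi, hc⟩] at h4; rw [h4, zero_mul]
    · rintro ⟨h1, h2⟩
      refine ⟨fun i hi => (h2 i hi).1, h1, ?_⟩
      ext i
      rw [hT₂, PiLp.zero_apply]
      split_ifs with hc
      · exact (mul_eq_zero.1 (h2 i hc.1).2).resolve_right hc.2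
      · rfl
  obtain ⟨C, hC, hoff⟩ := exists_hoffman_bound (T₁.prod T₂) (-fderiv ℝ A.obj u, 0) A.ineq
    ⟨lam, (hS lam).2 h.mem⟩
  obtain ⟨K, s, hs, hK⟩ := (contDiffAt_dLag h.obj_smooth h.con_smooth lam).exists_lipschitzOnWith
  have hs' : ∀ᶠ z : V × EuclideanSpace ℝ ι in 𝓝 u ×ˢ 𝓝[A.polar] lam, z ∈ s := by
    have : 𝓝 u ×ˢ 𝓝[A.polar] lam ≤ 𝓝 (u, lam) := by
      rw [nhds_prod_eq]; exact prod_mono le_rfl nhdsWithin_le_nhds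
    exact this hs
  have hsu : ∀ᶠ z : V × EuclideanSpace ℝ ι in 𝓝 u ×ˢ 𝓝[A.polar] lam, (u, z.2) ∈ s := by
    have : Tendsto (fun z : V × EuclideanSpace ℝ ι => (u, z.2)) (𝓝 u ×ˢ 𝓝[A.polar] lam)
        (𝓝 (u, lam)) := by
      rw [nhds_prod_eq]
      exact tendsto_const_nhds.prodMk (tendsto_snd.mono_right nhdsWithin_le_nhds)
    exact this hs
  have hpol : ∀ᶠ z : V × EuclideanSpace ℝ ι in 𝓝 u ×ˢ 𝓝[A.polar] lam, z.2 ∈ A.polar :=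
    tendsto_snd.eventually self_mem_nhdsWithin
  have hlamt : Tendsto (fun z : V × EuclideanSpace ℝ ι => z.2) (𝓝 u ×ˢ 𝓝[A.polar] lam) (𝓝 lam) :=
    tendsto_snd.mono_right nhdsWithin_le_nhds
  have hcont : Tendsto (fun z : V × EuclideanSpace ℝ ι => A.con z.1) (𝓝 u ×ˢ 𝓝[A.polar] lam)
      (𝓝 (A.con u)) := h.con_smooth.continuousAt.tendsto.comp tendsto_fst
  have hsmall : ∀ᶠ z : V × EuclideanSpace ℝ ι in 𝓝 u ×ˢ 𝓝[A.polar] lam,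
      ∀ i, i ∈ A.ineq ∧ A.con u i ≠ 0 → z.2 i + A.con z.1 i < 0 := by
    refine eventually_all.2 fun i => ?_
    by_cases hi : i ∈ A.ineq ∧ A.con u i ≠ 0
    · have h0 : lam i = 0 := (mul_eq_zero.1 (h.mem.2 i hi.1).2).resolve_right hi.2
      have h1 : A.con u i < 0 := lt_of_le_of_ne (h.feasible.1 i hi.1) hi.2
      have : Tendsto (fun z : V × EuclideanSpace ℝ ι => (z.2 + A.con z.1) i)
          (𝓝 u ×ˢ 𝓝[A.polar] lam) (𝓝 ((lam + A.con u) i)) :=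
        ((EuclideanSpace.proj (𝕜 := ℝ) i).continuous.tendsto _).comp (hlamt.add hcont)
      have h2 : (lam + A.con u) i < 0 := by rw [PiLp.add_apply, h0, zero_add]; exact h1
      exact (this.eventually (gt_mem_nhds h2)).mono fun _ hz _ => hz
    · exact Eventually.of_forall fun _ hi' => absurd hi' hi
  refine ⟨C * (1 + K), by positivity, ?_⟩
  filter_upwards [hs', hsu, hpol, hsmall] with z hz hzu hzp hzs
  obtain ⟨nu, hnu, hmin, hle⟩ := hoff z.2 hzp
  refine ⟨nu, (hS nu).1 hnu, hmin lam (fun i hi => (h.mem.2 i hi).1) ((hS lam).2 h.mem).2,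
    hle.trans ?_⟩
  rw [mul_assoc]
  refine mul_le_mul_of_nonneg_left ?_ hC.le
  rw [ContinuousLinearMap.prod_apply, Prod.mk_sub_mk, sub_neg_eq_add, sub_zero, add_comm (T₁ _),
    ← hT₁]
  have h1 : ‖A.dLag (u, z.2)‖ ≤ ‖A.dLag (z.1, z.2)‖ + K * ‖z.1 - u‖ := by
    have h2 := hK.dist_le_mul _ hzu _ hz
    rw [dist_eq_norm, dist_comm, dist_eq_norm, ← Prod.mk.eta (p := z), Prod.mk_sub_mk, sub_self,
      Prod.norm_mk, norm_zero, max_eq_left (norm_nonneg _)] at h2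
    have h3 := norm_le_norm_add_norm_sub' (A.dLag (u, z.2)) (A.dLag (z.1, z.2))
    exact h3.trans (by gcongr)
  -- The projection truncates an inactive coordinate nearby, so the residual contains `z.2 i`
  -- itself.
  have h2 : ‖T₂ z.2‖ ≤ ‖z.2 - A.proj (z.2 + A.con z.1)‖ := by
    refine norm_le_of_abs_le fun i => ?_
    rw [hT₂]
    split_ifs with hi
    · rw [PiLp.sub_apply, A.proj_apply_of_mem hi.1, max_eq_left, sub_zero]
      exact (hzs i hi).le
    · simp
  have h3 : (0:ℝ) ≤ K := K.2
  have h4 := A.res_nonneg z.1 z.2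
  refine (norm_prod_le_iff.2 ⟨?_, ?_⟩)
  · have : A.res z.1 z.2 = ‖A.dLag (z.1, z.2)‖ + ‖z.2 - A.proj (z.2 + A.con z.1)‖ := rfl
    nlinarith [norm_nonneg (z.2 - A.proj (z.2 + A.con z.1)), norm_nonneg (z.1 - u),
      mul_nonneg h3 h4]
  · have : A.res z.1 z.2 = ‖A.dLag (z.1, z.2)‖ + ‖z.2 - A.proj (z.2 + A.con z.1)‖ := rfl
    nlinarith [norm_nonneg (A.dLag (z.1, z.2)), norm_nonneg (z.1 - u),
      mul_nonneg h3 h4, mul_nonneg h3 (norm_nonneg (z.1 - u))]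

end SOSC

end ConeProgram

theorem Ultrafilter.exists_direction {α E : Type*} [NormedAddCommGroup E] [NormedSpace ℝ E]
    [ProperSpace E] (U : Ultrafilter α) {v : α → E} {a : E}
    (hne : ∀ᶠ x in (U : Filter α), 0 < ‖v x - a‖) :
    ∃ d : E, d ≠ 0 ∧ Tendsto (fun x => ‖v x - a‖⁻¹ • (v x - a)) U (𝓝 d) := by
  have h1 : ∀ᶠ x in (U : Filter α), ‖‖v x - a‖⁻¹ • (v x - a)‖ = 1 := by
    filter_upwards [hne] with x hx
    rw [norm_smul, norm_inv, norm_norm, inv_mul_cancel₀ hx.ne']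
  obtain ⟨d, hd⟩ := U.exists_tendsto_of_norm_le (h1.mono fun _ h => h.le)
  refine ⟨d, ?_, hd⟩
  rw [← norm_ne_zero_iff, tendsto_nhds_unique hd.norm ((tendsto_congr' h1).2 tendsto_const_nhds)]
  exact one_ne_zero

theorem HasFDerivAt.tendsto_direction {α E F : Type*} [NormedAddCommGroup E] [NormedSpace ℝ E]
    [NormedAddCommGroup F] [NormedSpace ℝ F] {l : Filter α} {f : E → F} {f' : E →L[ℝ] F} {a d : E}
    (hf : HasFDerivAt f f' a) {v : α → E} (hv : Tendsto v l (𝓝 a))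
    (hd : Tendsto (fun x => ‖v x - a‖⁻¹ • (v x - a)) l (𝓝 d)) :
    Tendsto (fun x => ‖v x - a‖⁻¹ • (f (v x) - f a)) l (𝓝 (f' d)) := by
  have h1 := ((hf.isLittleO.comp_tendsto hv).norm_right).tendsto_inv_smul_nhds_zero
  have h2 := h1.add ((f'.continuous.tendsto d).comp hd)
  rw [zero_add] at h2
  refine h2.congr fun x => ?_
  simp [smul_sub]

theorem tendsto_inv_smul_zero_of_norm_le {α F : Type*} [NormedAddCommGroup F] [NormedSpace ℝ F]
    {l : Filter α} {t r : α → ℝ} {f : α → F} (hr : Tendsto (fun p => (t p)⁻¹ * r p) l (𝓝 0))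
    (ht : ∀ p, 0 ≤ t p) (hf : ∀ p, ‖f p‖ ≤ r p) :
    Tendsto (fun p => (t p)⁻¹ • f p) l (𝓝 0) := by
  refine squeeze_zero_norm (fun p => ?_) hr
  rw [norm_smul, norm_inv, Real.norm_of_nonneg (ht p)]
  exact mul_le_mul_of_nonneg_left (hf p) (inv_nonneg.2 (ht p))

/-! ### The local error bound -/

namespace ConeProgram

variable {V ι : Type*} [Fintype ι] [NormedAddCommGroup V] [InnerProductSpace ℝ V] [ProperSpace V]
  {A : ConeProgram V ι} {u : V} {lam : EuclideanSpace ℝ ι}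

namespace SOSC

/-- The KKT residual bounds the distance of the primal variable to `u`. -/
theorem exists_norm_sub_le_res (h : A.SOSC u lam) :
    ∃ C > 0, ∀ᶠ z : V × EuclideanSpace ℝ ι in 𝓝 u ×ˢ 𝓝[A.polar] lam,
      ‖z.1 - u‖ ≤ C * A.res z.1 z.2 := by
  obtain ⟨C, hC, hdist⟩ := h.exists_dist_multipliers_le
  have key : ∀ᶠ p : ℝ × (V × EuclideanSpace ℝ ι) in 𝓝[>] 0 ×ˢ (𝓝 u ×ˢ 𝓝[A.polar] lam),
      p.1 * ‖p.2.1 - u‖ ≤ A.res p.2.1 p.2.2 := by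
    refine eventually_of_ultrafilter fun U hU hneg => ?_
    have heps0 : Tendsto (fun p : ℝ × (V × EuclideanSpace ℝ ι) => p.1) U (𝓝[>] 0) :=
      tendsto_fst.mono_left hU
    have heps : Tendsto (fun p : ℝ × (V × EuclideanSpace ℝ ι) => p.1) U (𝓝 0) :=
      heps0.mono_right nhdsWithin_le_nhds
    have hz : Tendsto (fun p : ℝ × (V × EuclideanSpace ℝ ι) => p.2) U (𝓝 u ×ˢ 𝓝[A.polar] lam) :=
      tendsto_snd.mono_left hU
    have hu : Tendsto (fun p : ℝ × (V × EuclideanSpace ℝ ι) => p.2.1) U (𝓝 u) :=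
      tendsto_fst.comp hz
    have hl0 : Tendsto (fun p : ℝ × (V × EuclideanSpace ℝ ι) => p.2.2) U (𝓝[A.polar] lam) :=
      tendsto_snd.comp hz
    have hl : Tendsto (fun p : ℝ × (V × EuclideanSpace ℝ ι) => p.2.2) U (𝓝 lam) :=
      hl0.mono_right nhdsWithin_le_nhds
    have hpol : ∀ᶠ p in (U : Filter (ℝ × (V × EuclideanSpace ℝ ι))), p.2.2 ∈ A.polar :=
      hl0.eventually self_mem_nhdsWithin
    have hpos : ∀ᶠ p in (U : Filter (ℝ × (V × EuclideanSpace ℝ ι))), 0 < ‖p.2.1 - u‖ := by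
      filter_upwards [hneg] with p hp
      refine lt_of_le_of_ne (norm_nonneg _) fun h0 => hp ?_
      rw [← h0, mul_zero]; exact A.res_nonneg _ _
    obtain ⟨d, hd0, hd⟩ := U.exists_direction hpos
    obtain ⟨nu, hnu⟩ := (hz.eventually hdist).choice
    have hres : Tendsto (fun p : ℝ × (V × EuclideanSpace ℝ ι) =>
        ‖p.2.1 - u‖⁻¹ * A.res p.2.1 p.2.2) U (𝓝 0) := by
      refine squeeze_zero' (Eventually.of_forall fun p =>
        mul_nonneg (inv_nonneg.2 (norm_nonneg _)) (A.res_nonneg _ _)) ?_ heps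
      filter_upwards [hneg, hpos] with p hp h0
      rw [inv_mul_le_iff₀ h0, mul_comm]
      exact (not_le.1 hp).le
    have hnul : Tendsto nu U (𝓝 lam) := by
      rw [tendsto_iff_norm_sub_tendsto_zero] at hl ⊢
      refine squeeze_zero' (Eventually.of_forall fun p => norm_nonneg _) ?_
        (g := fun p => 2 * ‖p.2.2 - lam‖) (by simpa using hl.const_mul 2)
      filter_upwards [hnu] with p hp
      have := norm_sub_le_norm_sub_add_norm_sub (nu p) p.2.2 lam
      rw [norm_sub_rev (nu p) p.2.2] at this
      linarith [hp.2.1]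
    -- Where the inequality fails with constant below one, the residual is at most `‖p.2.1 - u‖`.
    -- The dual distance is then of the same order, so the scaled dual difference has a limit `eta`.
    have heta1 : ∀ᶠ p in (U : Filter (ℝ × (V × EuclideanSpace ℝ ι))),
        ‖p.2.2 - nu p‖ ≤ 2 * C * ‖p.2.1 - u‖ := by
      filter_upwards [hnu, hneg, heps.eventually (gt_mem_nhds one_pos)] with p hp h1 h2
      have h3 : A.res p.2.1 p.2.2 ≤ ‖p.2.1 - u‖ :=
        (not_le.1 h1).le.trans (by nlinarith [norm_nonneg (p.2.1 - u)])
      refine hp.2.2.trans ?_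
      nlinarith
    obtain ⟨eta, heta⟩ := U.exists_tendsto_of_norm_le
      (f := fun p => ‖p.2.1 - u‖⁻¹ • (p.2.2 - nu p)) (C := 2 * C) (by
        filter_upwards [heta1, hpos] with p hp h0
        rw [norm_smul, norm_inv, norm_norm, inv_mul_le_iff₀ h0, mul_comm]
        exact hp)
    -- the limit of the stationarity condition
    have hstat : fderiv ℝ A.dLag (u, lam) (d, eta) = 0 := by
      have h1 : Tendsto (fun p : ℝ × (V × EuclideanSpace ℝ ι) =>
          (((p.2.1, p.2.2), (u, nu p)) :
            (V × EuclideanSpace ℝ ι) × (V × EuclideanSpace ℝ ι))) U (𝓝 ((u, lam), (u, lam))) :=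
        (hu.prodMk_nhds hl).prodMk_nhds (tendsto_const_nhds.prodMk_nhds hnul)
      have h2 := h.hasStrictFDerivAt_dLag.isLittleO.comp_tendsto h1
      have h3 : (fun p : ℝ × (V × EuclideanSpace ℝ ι) =>
          ((p.2.1, p.2.2) : V × EuclideanSpace ℝ ι) - (u, nu p)) =O[U] fun p => ‖p.2.1 - u‖ := by
        refine Asymptotics.IsBigO.of_bound (1 + 2 * C) ?_
        filter_upwards [heta1] with p hp
        rw [norm_norm, Prod.mk_sub_mk, norm_prod_le_iff]
        constructor <;> nlinarith [norm_nonneg (p.2.1 - u)]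
      have h4 := (h2.trans_isBigO h3).tendsto_inv_smul_nhds_zero
      have h5 : Tendsto (fun p : ℝ × (V × EuclideanSpace ℝ ι) => ‖p.2.1 - u‖⁻¹ • A.dLag p.2) U
          (𝓝 0) := tendsto_inv_smul_zero_of_norm_le hres (fun p => norm_nonneg _) fun p => by
        unfold res; linarith [norm_nonneg (p.2.2 - A.proj (p.2.2 + A.con p.2.1))]
      have h6 : Tendsto (fun p : ℝ × (V × EuclideanSpace ℝ ι) => fderiv ℝ A.dLag (u, lam)
          (‖p.2.1 - u‖⁻¹ • (p.2.1 - u), ‖p.2.1 - u‖⁻¹ • (p.2.2 - nu p))) U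
          (𝓝 (fderiv ℝ A.dLag (u, lam) (d, eta))) :=
        ((fderiv ℝ A.dLag (u, lam)).continuous.tendsto _).comp (hd.prodMk_nhds heta)
      have h7 := h5.sub h4
      rw [sub_zero] at h7
      refine tendsto_nhds_unique h6 (h7.congr' ?_)
      filter_upwards [hnu] with p hp
      have h8 := hp.1.1
      have h9 : fderiv ℝ A.dLag (u, lam)
          (‖p.2.1 - u‖⁻¹ • (p.2.1 - u), ‖p.2.1 - u‖⁻¹ • (p.2.2 - nu p)) =
          ‖p.2.1 - u‖⁻¹ • fderiv ℝ A.dLag (u, lam) (p.2 - (u, nu p)) :=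
        map_smul (fderiv ℝ A.dLag (u, lam)) ‖p.2.1 - u‖⁻¹ (p.2 - (u, nu p))
      rw [h9, Function.comp_apply]
      simp only [Prod.mk.eta, h8, sub_zero]
      module
    have hcon : ∀ i, Tendsto (fun p : ℝ × (V × EuclideanSpace ℝ ι) =>
        ‖p.2.1 - u‖⁻¹ * (A.con p.2.1 i - A.con u i)) U (𝓝 (fderiv ℝ A.con u d i)) := fun i =>
      ((EuclideanSpace.proj (𝕜 := ℝ) i).continuous.tendsto _).comp
        ((h.con_smooth.differentiableAt (by norm_num)).hasFDerivAt.tendsto_direction hu hd)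
    have hcomp : ∀ i, Tendsto (fun p : ℝ × (V × EuclideanSpace ℝ ι) =>
        ‖p.2.1 - u‖⁻¹ * (p.2.2 i - A.proj (p.2.2 + A.con p.2.1) i)) U (𝓝 0) := fun i =>
      tendsto_inv_smul_zero_of_norm_le hres (fun p => norm_nonneg _) fun p => by
        have := PiLp.norm_apply_le (p.2.2 - A.proj (p.2.2 + A.con p.2.1)) i
        unfold res
        exact this.trans (by linarith [norm_nonneg (A.dLag (p.2.1, p.2.2))])
    have hetai : ∀ i, Tendsto (fun p : ℝ × (V × EuclideanSpace ℝ ι) =>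
        ‖p.2.1 - u‖⁻¹ * (p.2.2 i - nu p i)) U (𝓝 (eta i)) := fun i =>
      ((EuclideanSpace.proj (𝕜 := ℝ) i).continuous.tendsto _).comp heta
    have hli : ∀ i, Tendsto (fun p : ℝ × (V × EuclideanSpace ℝ ι) => p.2.2 i) U (𝓝 (lam i)) :=
      fun i => ((EuclideanSpace.proj (𝕜 := ℝ) i).continuous.tendsto _).comp hl
    have hci : ∀ i, Tendsto (fun p : ℝ × (V × EuclideanSpace ℝ ι) => A.con p.2.1 i) U
        (𝓝 (A.con u i)) := fun i =>
      ((EuclideanSpace.proj (𝕜 := ℝ) i).continuous.tendsto _).comp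
        (h.con_smooth.continuousAt.tendsto.comp hu)
    -- the alternatives in the complementarity residual
    have hcase1 : ∀ i ∈ A.ineq, (∀ᶠ p in (U : Filter (ℝ × (V × EuclideanSpace ℝ ι))),
        0 ≤ p.2.2 i + A.con p.2.1 i) → Tendsto (fun p : ℝ × (V × EuclideanSpace ℝ ι) =>
        ‖p.2.1 - u‖⁻¹ * A.con p.2.1 i) U (𝓝 0) := by
      intro i hi h1
      have h2 := (hcomp i).neg
      rw [neg_zero] at h2
      refine h2.congr' ?_
      filter_upwards [h1] with p hp
      rw [A.proj_apply_of_mem hi, PiLp.add_apply, max_eq_right hp]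
      ring
    have hcase2 : ∀ i ∈ A.ineq, (∀ᶠ p in (U : Filter (ℝ × (V × EuclideanSpace ℝ ι))),
        p.2.2 i + A.con p.2.1 i ≤ 0) → Tendsto (fun p : ℝ × (V × EuclideanSpace ℝ ι) =>
        ‖p.2.1 - u‖⁻¹ * p.2.2 i) U (𝓝 0) := by
      intro i hi h1
      refine (hcomp i).congr' ?_
      filter_upwards [h1] with p hp
      rw [A.proj_apply_of_mem hi, PiLp.add_apply, max_eq_left hp, sub_zero]
    have hcase : ∀ i, (∀ᶠ p in (U : Filter (ℝ × (V × EuclideanSpace ℝ ι))),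
        0 ≤ p.2.2 i + A.con p.2.1 i) ∨ (∀ᶠ p in (U : Filter (ℝ × (V × EuclideanSpace ℝ ι))),
        p.2.2 i + A.con p.2.1 i ≤ 0) := fun i =>
      Ultrafilter.eventually_or.1 (Eventually.of_forall fun p => le_total _ _)
    have heq : ∀ i ∉ A.ineq, fderiv ℝ A.con u d i = 0 := by
      intro i hi
      have h2 := (hcomp i).neg
      rw [neg_zero] at h2
      refine tendsto_nhds_unique (hcon i) (h2.congr fun p => ?_)
      rw [A.proj_apply_of_notMem hi, PiLp.add_apply, h.feasible.2 i hi]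
      ring
    have hcon' : ∀ i, A.con u i = 0 → Tendsto (fun p : ℝ × (V × EuclideanSpace ℝ ι) =>
        ‖p.2.1 - u‖⁻¹ * A.con p.2.1 i) U (𝓝 (fderiv ℝ A.con u d i)) := fun i h0 => by
      simpa [h0] using hcon i
    have hle : ∀ i ∈ A.ineq, A.con u i = 0 → fderiv ℝ A.con u d i ≤ 0 := by
      intro i hi h0
      rcases hcase i with h1 | h1
      · exact (tendsto_nhds_unique (hcon' i h0) (hcase1 i hi h1)).le
      · refine le_of_tendsto (hcon' i h0) ?_
        filter_upwards [h1, hpol] with p hp hq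
        exact mul_nonpos_of_nonneg_of_nonpos (inv_nonneg.2 (norm_nonneg _))
          (by linarith [hq i hi])
    have hstrong : ∀ i ∈ A.ineq, A.con u i = 0 → 0 < lam i → fderiv ℝ A.con u d i = 0 := by
      intro i hi h0 h1
      refine tendsto_nhds_unique (hcon' i h0) (hcase1 i hi ?_)
      have : Tendsto (fun p : ℝ × (V × EuclideanSpace ℝ ι) => p.2.2 i + A.con p.2.1 i) U
          (𝓝 (lam i + A.con u i)) := (hli i).add (hci i)
      rw [h0, add_zero] at this
      exact (this.eventually (lt_mem_nhds h1)).mono fun _ h => h.le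
    -- For an active constraint, either its linearisation vanishes, or `p.2.2 i` is negligible at
    -- this scale; then `nu p i ≥ 0` gives `eta i ≤ 0`, matching the sign of the linearisation. For
    -- an inactive one, `eta i = 0`.
    have hprod : ∀ i, 0 ≤ eta i * fderiv ℝ A.con u d i := by
      intro i
      by_cases hi : i ∈ A.ineq
      · by_cases h0 : A.con u i = 0
        · rcases hcase i with h1 | h1
          · rw [tendsto_nhds_unique (hcon' i h0) (hcase1 i hi h1), mul_zero]
          · refine mul_nonneg_of_nonpos_of_nonpos ?_ (hle i hi h0)
            refine le_of_tendsto_of_tendsto (hetai i) (hcase2 i hi h1) ?_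
            filter_upwards [hnu] with p hp
            exact mul_le_mul_of_nonneg_left (by linarith [(hp.1.2 i hi).1])
              (inv_nonneg.2 (norm_nonneg _))
        · have h1 : lam i = 0 := (mul_eq_zero.1 (h.mem.2 i hi).2).resolve_right h0
          have h2 : ∀ᶠ p in (U : Filter (ℝ × (V × EuclideanSpace ℝ ι))),
              p.2.2 i + A.con p.2.1 i ≤ 0 := by
            have : Tendsto (fun p : ℝ × (V × EuclideanSpace ℝ ι) => p.2.2 i + A.con p.2.1 i) U
              (𝓝 (lam i + A.con u i)) := (hli i).add (hci i)
            rw [h1, zero_add] at this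
            exact (this.eventually (gt_mem_nhds
              (lt_of_le_of_ne (h.feasible.1 i hi) h0))).mono fun _ h => h.le
          have h3 : eta i = 0 := by
            refine tendsto_nhds_unique (hetai i) ((hcase2 i hi h2).congr' ?_)
            filter_upwards [hnu] with p hp
            rw [(mul_eq_zero.1 (hp.1.2 i hi).2).resolve_right h0, sub_zero]
          rw [h3, zero_mul]
      · rw [heq i hi, mul_zero]
    -- The limiting stationarity condition, evaluated at `d`, writes zero as a positive number plus
    -- nonnegative ones.
    have hfin := h.pos_of_strong hd0 heq hle hstrong
    have h1 : fderiv ℝ A.dLag (u, lam) (d, eta) d =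
        fderiv ℝ A.dLag (u, lam) (d, 0) d + inner ℝ eta (fderiv ℝ A.con u d) := by
      rw [← h.fderiv_dLag_snd, ← add_apply, ← map_add, Prod.mk_add_mk, add_zero, zero_add]
    rw [hstat, inner_eq_sum, zero_apply] at h1
    have h2 := Finset.sum_nonneg fun i (_ : i ∈ Finset.univ) => hprod i
    linarith
  obtain ⟨ε, hε, hε0⟩ := (key.curry.and self_mem_nhdsWithin).exists
  have hε0 : 0 < ε := hε0
  refine ⟨ε⁻¹, inv_pos.2 hε0, hε.mono fun z hz => ?_⟩
  rw [← div_eq_inv_mul, le_div_iff₀ hε0, mul_comm]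
  exact hz

/-- The local error bound: the KKT residual bounds the distance to the set of KKT points. -/
theorem exists_error_bound (h : A.SOSC u lam) :
    ∃ C > 0, ∀ᶠ z : V × EuclideanSpace ℝ ι in 𝓝 u ×ˢ 𝓝[A.polar] lam,
      ‖z.1 - u‖ ≤ C * A.res z.1 z.2 ∧
      ∃ nu ∈ A.multipliers u, ‖z.2 - nu‖ ≤ ‖z.2 - lam‖ ∧ ‖z.2 - nu‖ ≤ C * A.res z.1 z.2 := by
  obtain ⟨C₁, hC₁, h1⟩ := h.exists_dist_multipliers_le
  obtain ⟨C₂, hC₂, h2⟩ := h.exists_norm_sub_le_res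
  refine ⟨C₁ * (1 + C₂) + C₂, by positivity, ?_⟩
  filter_upwards [h1, h2] with z hz1 hz2
  have h0 := A.res_nonneg z.1 z.2
  refine ⟨hz2.trans ?_, ?_⟩
  · have : 0 ≤ C₁ * (1 + C₂) * A.res z.1 z.2 := by positivity
    linarith
  · obtain ⟨nu, hnu, h3, h4⟩ := hz1
    refine ⟨nu, hnu, h3, h4.trans ?_⟩
    have := mul_le_mul_of_nonneg_left hz2 hC₁.le
    have : 0 ≤ C₂ * A.res z.1 z.2 := by positivity
    linarith

end SOSC

end ConeProgram

/-! ### Quadratic growth of the augmented Lagrangian -/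

namespace ConeProgram

variable {V ι : Type*} [Fintype ι] [NormedAddCommGroup V] [InnerProductSpace ℝ V]
  {A : ConeProgram V ι} {u : V} {lam : EuclideanSpace ℝ ι}

namespace SOSC

/-- The second-order expansion of the Lagrangian at `u`, uniformly in multipliers near `lam`. -/
theorem eventually_lagr_taylor (h : A.SOSC u lam) {ε : ℝ} (hε : 0 < ε) :
    ∀ᶠ z : V × EuclideanSpace ℝ ι in 𝓝 u ×ˢ 𝓝[A.multipliers u] lam,
      |A.lagr z.1 z.2 - A.obj u - fderiv ℝ A.dLag (u, lam) (z.1 - u, 0) (z.1 - u) / 2| ≤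
        ε * ‖z.1 - u‖ ^ 2 := by
  obtain ⟨δ₁, hδ₁, h1⟩ := Metric.eventually_nhds_iff.1 (h.hasStrictFDerivAt_dLag.isLittleO.def hε)
  obtain ⟨δ₂, hδ₂, h2⟩ := Metric.eventually_nhds_iff.1
    (eventually_differentiableAt h.obj_smooth h.con_smooth)
  have e1 : ∀ᶠ z : V × EuclideanSpace ℝ ι in 𝓝 u ×ˢ 𝓝[A.multipliers u] lam,
      dist z.1 u < min δ₁ δ₂ :=
    tendsto_fst.eventually (Metric.ball_mem_nhds u (lt_min hδ₁ hδ₂))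
  have e2 : ∀ᶠ z : V × EuclideanSpace ℝ ι in 𝓝 u ×ˢ 𝓝[A.multipliers u] lam, dist z.2 lam < δ₁ :=
    (tendsto_snd.mono_right nhdsWithin_le_nhds).eventually (Metric.ball_mem_nhds lam hδ₁)
  have e3 : ∀ᶠ z : V × EuclideanSpace ℝ ι in 𝓝 u ×ˢ 𝓝[A.multipliers u] lam,
      z.2 ∈ A.multipliers u := tendsto_snd.eventually self_mem_nhdsWithin
  filter_upwards [e1, e2, e3] with z hz1 hz2 hz3
  set v := z.1 - u with hv
  have hvs : ∀ s ∈ Set.Icc (0 : ℝ) 1, dist (u + s • v) u < min δ₁ δ₂ := fun s hs => by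
    refine lt_of_le_of_lt ?_ hz1
    rw [dist_eq_norm, dist_eq_norm, add_sub_cancel_left, ← hv, norm_smul, Real.norm_of_nonneg hs.1]
    exact mul_le_of_le_one_left (norm_nonneg _) hs.2
  -- The mean value inequality is applied on `[0, 1]` to the Lagrangian along the segment minus its
  -- second-order model. The first-order term is absent because `z.2` is a multiplier, and strict
  -- differentiability makes the bound uniform in it.
  have hder : ∀ s ∈ Set.Icc (0 : ℝ) 1, HasDerivWithinAt (fun s : ℝ => A.lagr (u + s • v) z.2 -
      s ^ 2 * (fderiv ℝ A.dLag (u, lam) (v, 0) v / 2))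
      (A.dLag (u + s • v, z.2) v - s * fderiv ℝ A.dLag (u, lam) (v, 0) v) (Set.Icc 0 1) s := by
    intro s hs
    obtain ⟨ho, hc⟩ := h2 ((hvs s hs).trans_le (min_le_right _ _))
    have hg : HasDerivAt (fun s : ℝ => u + s • v) v s := by
      simpa using ((hasDerivAt_id s).smul_const v).const_add u
    have h3 := (A.hasFDerivAt_lagr ho hc z.2).comp_hasDerivAt s hg
    have h4 := ((hasDerivAt_id s).pow 2).mul_const (fderiv ℝ A.dLag (u, lam) (v, 0) v / 2)
    refine ((h3.sub h4).congr_deriv ?_).hasDerivWithinAt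
    simp
    ring
  have hbd : ∀ s ∈ Set.Icc (0 : ℝ) 1, ‖A.dLag (u + s • v, z.2) v -
      s * fderiv ℝ A.dLag (u, lam) (v, 0) v‖ ≤ ε * ‖v‖ ^ 2 := by
    intro s hs
    have h3 := h1 (y := ((u + s • v, z.2), (u, z.2))) (by
      simp only [Prod.dist_eq, max_lt_iff]
      exact ⟨⟨(hvs s hs).trans_le (min_le_left _ _), hz2⟩, by simpa using hδ₁, hz2⟩)
    simp only [hz3.1, sub_zero, Prod.mk_sub_mk, add_sub_cancel_left, sub_self] at h3
    have h4 : ‖((s • v, 0) : V × EuclideanSpace ℝ ι)‖ ≤ ‖v‖ := by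
      rw [Prod.norm_mk, norm_zero, max_eq_left (norm_nonneg _), norm_smul,
        Real.norm_of_nonneg hs.1]
      exact mul_le_of_le_one_left (norm_nonneg _) hs.2
    have h5 : A.dLag (u + s • v, z.2) v - s * fderiv ℝ A.dLag (u, lam) (v, 0) v =
        (A.dLag (u + s • v, z.2) - fderiv ℝ A.dLag (u, lam) (s • v, 0)) v := by
      have : ((s • v, 0) : V × EuclideanSpace ℝ ι) = s • (v, 0) := by simp
      rw [this, map_smul]
      simp
    rw [h5, sq, ← mul_assoc]
    refine (ContinuousLinearMap.le_opNorm _ _).trans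
      (mul_le_mul_of_nonneg_right (h3.trans ?_) (norm_nonneg _))
    exact mul_le_mul_of_nonneg_left h4 hε.le
  have h6 := Convex.norm_image_sub_le_of_norm_hasDerivWithin_le hder hbd (convex_Icc 0 1)
    (Set.left_mem_Icc.2 zero_le_one) (Set.right_mem_Icc.2 zero_le_one)
  simp only [one_smul, zero_smul, add_zero, one_pow, one_mul, sub_zero, norm_one, mul_one,
    Real.norm_eq_abs, h.feasible.lagr_eq_obj hz3, hv, add_sub_cancel] at h6
  convert h6 using 2
  ring

variable [ProperSpace V]

/-- Quadratic growth of the augmented Lagrangian, uniformly in multipliers near `lam`. -/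
theorem exists_aug_growth (h : A.SOSC u lam) :
    ∃ γ > 0, ∀ᶠ p : (V × EuclideanSpace ℝ ι) × ℝ in (𝓝 u ×ˢ 𝓝[A.multipliers u] lam) ×ˢ atTop,
      A.obj u + γ * ‖p.1.1 - u‖ ^ 2 ≤ A.aug p.2 p.1.1 p.1.2 := by
  have key : ∀ᶠ p : ℝ × ((V × EuclideanSpace ℝ ι) × ℝ) in
      𝓝[>] 0 ×ˢ ((𝓝 u ×ˢ 𝓝[A.multipliers u] lam) ×ˢ atTop),
      A.obj u + p.1 * ‖p.2.1.1 - u‖ ^ 2 ≤ A.aug p.2.2 p.2.1.1 p.2.1.2 := by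
    refine eventually_of_ultrafilter fun U hU hneg => ?_
    have hg : Tendsto (fun p : ℝ × ((V × EuclideanSpace ℝ ι) × ℝ) => p.1) U (𝓝 0) :=
      (tendsto_fst.mono_left hU).mono_right nhdsWithin_le_nhds
    have hp2 : Tendsto (fun p : ℝ × ((V × EuclideanSpace ℝ ι) × ℝ) => p.2) U
        ((𝓝 u ×ˢ 𝓝[A.multipliers u] lam) ×ˢ atTop) := tendsto_snd.mono_left hU
    have hz : Tendsto (fun p : ℝ × ((V × EuclideanSpace ℝ ι) × ℝ) => p.2.1) U
        (𝓝 u ×ˢ 𝓝[A.multipliers u] lam) := tendsto_fst.comp hp2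
    have hrho : Tendsto (fun p : ℝ × ((V × EuclideanSpace ℝ ι) × ℝ) => p.2.2) U atTop :=
      tendsto_snd.comp hp2
    have hu : Tendsto (fun p : ℝ × ((V × EuclideanSpace ℝ ι) × ℝ) => p.2.1.1) U (𝓝 u) :=
      tendsto_fst.comp hz
    have hl0 : Tendsto (fun p : ℝ × ((V × EuclideanSpace ℝ ι) × ℝ) => p.2.1.2) U
      (𝓝[A.multipliers u] lam) := tendsto_snd.comp hz
    have hl : Tendsto (fun p : ℝ × ((V × EuclideanSpace ℝ ι) × ℝ) => p.2.1.2) U (𝓝 lam) :=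
      hl0.mono_right nhdsWithin_le_nhds
    have hmul : ∀ᶠ p in (U : Filter (ℝ × ((V × EuclideanSpace ℝ ι) × ℝ))),
        p.2.1.2 ∈ A.multipliers u := hl0.eventually self_mem_nhdsWithin
    have hrho0 : ∀ᶠ p in (U : Filter (ℝ × ((V × EuclideanSpace ℝ ι) × ℝ))), 0 < p.2.2 :=
      hrho.eventually (eventually_gt_atTop 0)
    have hexc : ∀ᶠ p in (U : Filter (ℝ × ((V × EuclideanSpace ℝ ι) × ℝ))),
        ∀ i, 0 ≤ A.excess p.2.2 p.2.1.1 p.2.1.2 i := by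
      filter_upwards [hmul, hrho0] with p hp h0 i
      exact A.excess_nonneg h0 _ (mem_polar_of_mem_multipliers hp) i
    have hpos : ∀ᶠ p in (U : Filter (ℝ × ((V × EuclideanSpace ℝ ι) × ℝ))), 0 < ‖p.2.1.1 - u‖ := by
      filter_upwards [hneg, hmul, hexc] with p hp hm he
      refine lt_of_le_of_ne (norm_nonneg _) fun h0 => hp ?_
      have h1 : p.2.1.1 = u := by rw [← sub_eq_zero, ← norm_eq_zero, ← h0]
      rw [← h0, h1, A.aug_eq_lagr_add, h.feasible.lagr_eq_obj hm]
      rw [h1] at he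
      simpa using Finset.sum_nonneg fun i (_ : i ∈ Finset.univ) => he i
    obtain ⟨d, hd0, hd⟩ := U.exists_direction hpos
    set q : ℝ := fderiv ℝ A.dLag (u, lam) (d, 0) d / 2 with hq
    have hlagr : Tendsto (fun p : ℝ × ((V × EuclideanSpace ℝ ι) × ℝ) =>
        (A.lagr p.2.1.1 p.2.1.2 - A.obj u) / ‖p.2.1.1 - u‖ ^ 2) U (𝓝 q) := by
      have h1 : Tendsto (fun p : ℝ × ((V × EuclideanSpace ℝ ι) × ℝ) =>
          fderiv ℝ A.dLag (u, lam) (‖p.2.1.1 - u‖⁻¹ • (p.2.1.1 - u), 0)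
            (‖p.2.1.1 - u‖⁻¹ • (p.2.1.1 - u)) / 2) U (𝓝 q) := by
        refine Tendsto.div_const ?_ 2
        have h3 : Continuous fun d : V => fderiv ℝ A.dLag (u, lam) (d, 0) d := by fun_prop
        exact (h3.tendsto d).comp hd
      have h2 : Tendsto (fun p : ℝ × ((V × EuclideanSpace ℝ ι) × ℝ) =>
          (A.lagr p.2.1.1 p.2.1.2 - A.obj u - fderiv ℝ A.dLag (u, lam) (p.2.1.1 - u, 0)
            (p.2.1.1 - u) / 2) / ‖p.2.1.1 - u‖ ^ 2) U (𝓝 0) := by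
        rw [Metric.tendsto_nhds]
        intro ε hε
        filter_upwards [hz.eventually (h.eventually_lagr_taylor (half_pos hε)), hpos] with p hp h0
        rw [dist_zero_right, norm_div, norm_pow, norm_norm, div_lt_iff₀ (by positivity),
          Real.norm_eq_abs]
        refine hp.trans_lt ?_
        have : 0 < ‖p.2.1.1 - u‖ ^ 2 := by positivity
        nlinarith
      have h3 := h2.add h1
      rw [zero_add] at h3
      refine h3.congr' ?_
      filter_upwards [hpos] with p h0
      have h4 : ((‖p.2.1.1 - u‖⁻¹ • (p.2.1.1 - u), 0) : V × EuclideanSpace ℝ ι) =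
        ‖p.2.1.1 - u‖⁻¹ • (p.2.1.1 - u, 0) := by simp
      rw [h4]
      simp only [map_smul, smul_apply, smul_eq_mul]
      field_simp
      ring
    -- the excess terms are of second order
    have hbound : ∀ᶠ p in (U : Filter (ℝ × ((V × EuclideanSpace ℝ ι) × ℝ))),
        ∀ i, A.excess p.2.2 p.2.1.1 p.2.1.2 i ≤ (2 - q) * ‖p.2.1.1 - u‖ ^ 2 := by
      -- With growth constant below `1` and the scaled Lagrangian difference above `q - 1`, the
      -- total scaled excess is below `1 - (q - 1)`.
      filter_upwards [hexc, hneg, hpos, hg.eventually (gt_mem_nhds one_pos),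
        hlagr.eventually (lt_mem_nhds (sub_one_lt q))] with p he hn h0 hg1 hq1 i
      have h1 := Finset.single_le_sum (fun j _ => he j) (Finset.mem_univ i)
      rw [A.aug_eq_lagr_add] at hn
      have h2 : 0 < ‖p.2.1.1 - u‖ ^ 2 := by positivity
      rw [lt_div_iff₀ h2] at hq1
      nlinarith
    have hq0 : q ≤ 0 := by
      refine le_of_tendsto_of_tendsto hlagr hg ?_
      filter_upwards [hexc, hneg, hpos] with p he hn h0
      rw [A.aug_eq_lagr_add] at hn
      have := Finset.sum_nonneg fun i (_ : i ∈ Finset.univ) => he i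
      rw [div_le_iff₀ (by positivity)]
      linarith
    have hcon : ∀ i, A.con u i = 0 → Tendsto (fun p : ℝ × ((V × EuclideanSpace ℝ ι) × ℝ) =>
        ‖p.2.1.1 - u‖⁻¹ * A.con p.2.1.1 i) U (𝓝 (fderiv ℝ A.con u d i)) := fun i h0 => by
      have := ((EuclideanSpace.proj (𝕜 := ℝ) i).continuous.tendsto _).comp
        ((h.con_smooth.differentiableAt (by norm_num)).hasFDerivAt.tendsto_direction hu hd)
      simpa [Function.comp_def, h0] using this
    -- An excess `rho / 2 * con ^ 2` of order `‖v - u‖ ^ 2` with `rho → ∞` forces `con` to be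
    -- negligible against `‖v - u‖`.
    have hquad : ∀ i, A.con u i = 0 → (∀ᶠ p in (U : Filter (ℝ × ((V × EuclideanSpace ℝ ι) × ℝ))),
        A.excess p.2.2 p.2.1.1 p.2.1.2 i = p.2.2 / 2 * A.con p.2.1.1 i ^ 2) →
        fderiv ℝ A.con u d i = 0 := by
      intro i h0 h1
      have h2 : Tendsto (fun p : ℝ × ((V × EuclideanSpace ℝ ι) × ℝ) => 2 * (2 - q) / p.2.2) U
          (𝓝 0) := hrho.const_div_atTop _
      have h3 := (hcon i h0).pow 2
      refine pow_eq_zero_iff two_ne_zero |>.1 (le_antisymm ?_ (sq_nonneg _))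
      refine le_of_tendsto_of_tendsto h3 h2 ?_
      filter_upwards [h1, hbound, hpos, hrho0] with p hp hb h5 h6
      have h7 := hb i
      rw [hp] at h7
      rw [le_div_iff₀ h6, mul_pow, inv_pow, mul_assoc, inv_mul_le_iff₀ (by positivity)]
      linarith
    have hcase : ∀ i, (∀ᶠ p in (U : Filter (ℝ × ((V × EuclideanSpace ℝ ι) × ℝ))),
        0 ≤ p.2.1.2 i + p.2.2 * A.con p.2.1.1 i) ∨
        (∀ᶠ p in (U : Filter (ℝ × ((V × EuclideanSpace ℝ ι) × ℝ))),
        p.2.1.2 i + p.2.2 * A.con p.2.1.1 i ≤ 0) := fun i =>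
      Ultrafilter.eventually_or.1 (Eventually.of_forall fun p => le_total _ _)
    have hmem : ∀ i ∈ A.ineq, A.con u i = 0 →
        (∀ᶠ p in (U : Filter (ℝ × ((V × EuclideanSpace ℝ ι) × ℝ))),
        0 ≤ p.2.1.2 i + p.2.2 * A.con p.2.1.1 i) → fderiv ℝ A.con u d i = 0 := by
      intro i hi h0 h1
      refine hquad i h0 ?_
      filter_upwards [h1, hrho0] with p hp h2
      exact A.excess_of_mem_of_nonneg hi h2 hp
    have hle : ∀ i ∈ A.ineq, A.con u i = 0 → fderiv ℝ A.con u d i ≤ 0 := by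
      intro i hi h0
      rcases hcase i with h1 | h1
      · exact (hmem i hi h0 h1).le
      · refine le_of_tendsto (hcon i h0) ?_
        filter_upwards [h1, hmul, hrho0] with p hp hm h2
        refine mul_nonpos_of_nonneg_of_nonpos (inv_nonneg.2 (norm_nonneg _)) ?_
        by_contra hc
        push Not at hc
        nlinarith [(hm.2 i hi).1, mul_pos h2 hc]
    have hstrong : ∀ i ∈ A.ineq, A.con u i = 0 → 0 < lam i → fderiv ℝ A.con u d i = 0 := by
      intro i hi h0 hlam
      rcases hcase i with h1 | h1
      · exact hmem i hi h0 h1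
      -- On the truncated branch the excess is at least half the multiplier times `-con`, and it is
      -- of second order. Division by `‖v - u‖` leaves `lam i * (-con' d) ≤ 0` in the limit.
      · have hli : Tendsto (fun p : ℝ × ((V × EuclideanSpace ℝ ι) × ℝ) => p.2.1.2 i) U
            (𝓝 (lam i)) := ((EuclideanSpace.proj (𝕜 := ℝ) i).continuous.tendsto _).comp hl
        have hn : Tendsto (fun p : ℝ × ((V × EuclideanSpace ℝ ι) × ℝ) => ‖p.2.1.1 - u‖) U
            (𝓝 0) := tendsto_iff_norm_sub_tendsto_zero.1 hu
        have h2 : Tendsto (fun p : ℝ × ((V × EuclideanSpace ℝ ι) × ℝ) =>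
            2 * (2 - q) * ‖p.2.1.1 - u‖) U (𝓝 0) := by simpa using hn.const_mul (2 * (2 - q))
        have h3 : lam i * (-fderiv ℝ A.con u d i) ≤ 0 := by
          refine le_of_tendsto_of_tendsto (hli.mul (hcon i h0).neg) h2 ?_
          filter_upwards [h1, hmul, hrho0, hbound, hpos] with p hp hm h4 h5 h6
          have h7 := (A.le_excess_of_mem hi h4 (hm.2 i hi).1 hp).trans (h5 i)
          have h8 : p.2.1.2 i * -(‖p.2.1.1 - u‖⁻¹ * A.con p.2.1.1 i) =
              ‖p.2.1.1 - u‖⁻¹ * (p.2.1.2 i * -A.con p.2.1.1 i) := by ring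
          rw [h8, inv_mul_le_iff₀ h6]
          nlinarith
        refine le_antisymm (hle i hi h0) ?_
        nlinarith
    have heq : ∀ i ∉ A.ineq, fderiv ℝ A.con u d i = 0 := fun i hi =>
      hquad i (h.feasible.2 i hi) (Eventually.of_forall fun p => A.excess_of_notMem hi _ _ _)
    have := h.pos_of_strong hd0 heq hle hstrong
    linarith
  obtain ⟨γ, hγ, hγ0⟩ := (key.curry.and self_mem_nhdsWithin).exists
  exact ⟨γ, hγ0, hγ⟩

end SOSC

end ConeProgram

/-! ### Solvability of the subproblems -/

namespace ConeProgram

variable {V ι : Type*} [Fintype ι]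

/-- Growth controls the update of a multiplier `nu` with penalty `rho / 4`, whereas the method
updates `lam` with `rho`. For an inequality with `c i ≤ 0` the displacement has size `min (lam i)
(-rho * c i)`; the minimum is 1-Lipschitz in `lam i`, and quartering its other argument shrinks it
at most fourfold. Squaring gives `32 = 2 * 4 ^ 2`. -/
theorem norm_proj_update_sub_sq_le (A : ConeProgram V ι) {rho : ℝ} (hrho : 0 < rho)
    {lam nu : EuclideanSpace ℝ ι} (hl : lam ∈ A.polar) (hn : nu ∈ A.polar)
    (c : EuclideanSpace ℝ ι) :
    ‖A.proj (lam + rho • c) - lam‖ ^ 2 ≤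
      32 * (‖A.proj (nu + (rho / 4) • c) - nu‖ ^ 2 + ‖lam - nu‖ ^ 2) := by
  rw [norm_sq_eq_sum, norm_sq_eq_sum, norm_sq_eq_sum, ← Finset.sum_add_distrib, Finset.mul_sum]
  refine Finset.sum_le_sum fun i _ => ?_
  suffices hs : |(A.proj (lam + rho • c) - lam) i| ≤
      4 * (|(A.proj (nu + (rho / 4) • c) - nu) i| + |(lam - nu) i|) by
    have h1 := pow_le_pow_left₀ (abs_nonneg _) hs 2
    rw [sq_abs] at h1
    nlinarith [sq_abs ((A.proj (nu + (rho / 4) • c) - nu) i), sq_abs ((lam - nu) i),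
      sq_nonneg (|(A.proj (nu + (rho / 4) • c) - nu) i| - |(lam - nu) i|)]
  by_cases hi : i ∈ A.ineq
  · simp only [PiLp.sub_apply, A.proj_apply_of_mem hi, PiLp.add_apply, PiLp.smul_apply, smul_eq_mul]
    have h1 := hl i hi
    have h2 := hn i hi
    rcases le_total 0 (c i) with hc | hc
    · have h3 : 0 ≤ rho * c i := by positivity
      rw [max_eq_right (by linarith), max_eq_right (by linarith), add_sub_cancel_left,
        add_sub_cancel_left, abs_of_nonneg h3, abs_of_nonneg (by linarith)]
      linarith [abs_nonneg (lam i - nu i)]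
    · have h3 : rho * c i ≤ 0 := mul_nonpos_of_nonneg_of_nonpos hrho.le hc
      have h4 := neg_abs_le (lam i - nu i)
      have h5 := le_abs_self (lam i - nu i)
      rcases le_total 0 (lam i + rho * c i) with h6 | h6 <;>
        rcases le_total 0 (nu i + rho / 4 * c i) with h7 | h7 <;>
        simp only [max_eq_right, max_eq_left, h6, h7] <;>
        rw [abs_of_nonpos (by linarith), abs_of_nonpos (by linarith)] <;> linarith
  · simp only [PiLp.sub_apply, A.proj_apply_of_notMem hi, PiLp.add_apply, PiLp.smul_apply,
      smul_eq_mul, add_sub_cancel_left]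
    rw [show rho * c i = 4 * (rho / 4 * c i) by ring, abs_mul (4 : ℝ), abs_of_pos (four_pos)]
    linarith [abs_nonneg (lam i - nu i)]

variable [NormedAddCommGroup V] [InnerProductSpace ℝ V] [ProperSpace V]
  {A : ConeProgram V ι} {u : V} {lam : EuclideanSpace ℝ ι}

namespace SOSC

/-- Solvability of the augmented Lagrangian subproblems: near `(u, lam)` there are stationary
points of the augmented Lagrangian whose distance to the current iterate is bounded by the
residual. -/
theorem exists_aug_stationary (h : A.SOSC u lam) :
    ∃ C > 0, ∃ rho₀ > (0 : ℝ), ∀ᶠ z : V × EuclideanSpace ℝ ι in 𝓝 u ×ˢ 𝓝[A.polar] lam, ∀ rho ≥ rho₀,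
      ∃ v, ‖v - u‖ ≤ ‖z.2 - lam‖ ∧ A.dLag (v, A.proj (z.2 + rho • A.con v)) = 0 ∧
        ‖v - z.1‖ + ‖A.proj (z.2 + rho • A.con v) - z.2‖ ≤ C * A.res z.1 z.2 := by
  obtain ⟨C, hC, hbound⟩ := h.exists_error_bound
  obtain ⟨γ, hγ, hgrowth⟩ := h.exists_aug_growth
  obtain ⟨pa, hpa, pb, hpb, hgrowth⟩ := eventually_prod_iff.1 hgrowth
  obtain ⟨p₁, hp₁, p₂, hp₂, hpa⟩ := eventually_prod_iff.1 hpa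
  obtain ⟨rho₁, hrho₁⟩ := eventually_atTop.1 hpb
  obtain ⟨δ₁, hδ₁, h1⟩ := Metric.eventually_nhds_iff.1 (hp₁.and
    (eventually_differentiableAt h.obj_smooth h.con_smooth))
  rw [eventually_nhdsWithin_iff] at hp₂
  obtain ⟨δ₂, hδ₂, h2⟩ := Metric.eventually_nhds_iff.1 hp₂
  set r := δ₁ / 2 with hr
  have hr0 : 0 < r := half_pos hδ₁
  have e1 : ∀ᶠ z : V × EuclideanSpace ℝ ι in 𝓝 u ×ˢ 𝓝[A.polar] lam,
      dist z.2 lam < min (δ₂ / 2) r :=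
    (tendsto_snd.mono_right nhdsWithin_le_nhds).eventually
      (Metric.ball_mem_nhds lam (lt_min (half_pos hδ₂) hr0))
  have e2 : ∀ᶠ z : V × EuclideanSpace ℝ ι in 𝓝 u ×ˢ 𝓝[A.polar] lam, z.2 ∈ A.polar :=
    tendsto_snd.eventually self_mem_nhdsWithin
  -- The `10` is `1 + 1` for passing from `v` to `z.1` through `u`, plus `8` for the multiplier
  -- update. Growth is used with penalty `rho / 4`, whence `4 * rho₁`; `γ⁻¹` ensures `γ * rho ≥ 1`.
  refine ⟨10 * C, by positivity, max (4 * rho₁) (max γ⁻¹ 1), by positivity, ?_⟩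
  filter_upwards [e1, e2, hbound] with z hz1 hz2 hz3 rho hrho
  rw [dist_eq_norm] at hz1
  obtain ⟨hzu, nu, hnu, hnl, hnC⟩ := hz3
  have hrho1 : rho₁ ≤ rho / 4 := by linarith [le_of_max_le_left hrho]
  have hrho2 : 1 ≤ γ * rho := by
    have := mul_le_mul_of_nonneg_left (le_of_max_le_left (le_of_max_le_right hrho)) hγ.le
    rwa [mul_inv_cancel₀ hγ.ne'] at this
  have hrho3 : 0 < rho := by linarith [le_of_max_le_right (le_of_max_le_right hrho)]
  have hnear : dist nu lam < δ₂ := by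
    rw [dist_eq_norm]
    have h3 := norm_sub_le_norm_sub_add_norm_sub nu z.2 lam
    rw [norm_sub_rev nu z.2] at h3
    linarith [hz1.trans_le (min_le_left _ _)]
  have hball : ∀ v ∈ Metric.closedBall u r, dist v u < δ₁ := fun v hv =>
    lt_of_le_of_lt hv (half_lt_self hδ₁)
  have hderiv : ∀ v ∈ Metric.closedBall u r, HasFDerivAt (fun v => A.aug rho v z.2)
      (A.dLag (v, A.proj (z.2 + rho • A.con v))) v := fun v hv =>
    A.hasFDerivAt_aug hrho3 (h1 (hball v hv)).2.1 (h1 (hball v hv)).2.2 z.2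
  obtain ⟨v, hv, hmin⟩ := (isCompact_closedBall u r).exists_isMinOn
    (Metric.nonempty_closedBall.2 hr0.le) (f := fun v => A.aug rho v z.2)
    fun v hv => (hderiv v hv).continuousAt.continuousWithinAt
  -- Both bounds use the Lagrangian at the update of `nu` with penalty `rho / 4`. Growth puts it
  -- above `obj u + γ * ‖v - u‖ ^ 2 + 2 * a ^ 2 / rho`, while recentring the proximal term from `nu`
  -- to `z.2` costs at most `(a ^ 2 + b ^ 2) / rho`. The factor `1 / 4` is what leaves a positive
  -- multiple of `a ^ 2`.
  have hmain : γ * rho * ‖v - u‖ ^ 2 + ‖A.proj (nu + (rho / 4) • A.con v) - nu‖ ^ 2 ≤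
      ‖z.2 - nu‖ ^ 2 := by
    have h3 : A.aug rho v z.2 ≤ A.obj u :=
      (hmin (Metric.mem_closedBall_self hr0.le)).trans (A.aug_le_obj hrho3 h.feasible z.2)
    have h4 := A.le_aug hrho3 v z.2 (A.proj_mem (nu + (rho / 4) • A.con v))
    have h5 := A.aug_eq (by positivity : 0 < rho / 4) v nu
    have h6 := hgrowth (hpa (h1 (hball v hv)).1 (h2 hnear hnu)) (hrho₁ _ hrho1)
    simp only at h6
    rw [h5] at h6
    have h7 := norm_sub_le_norm_sub_add_norm_sub (A.proj (nu + (rho / 4) • A.con v)) nu z.2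
    rw [norm_sub_rev nu] at h7
    set a := ‖A.proj (nu + (rho / 4) • A.con v) - nu‖
    set b := ‖z.2 - nu‖
    have h8 : ‖A.proj (nu + (rho / 4) • A.con v) - z.2‖ ^ 2 ≤ 2 * (a ^ 2 + b ^ 2) := by
      nlinarith [norm_nonneg (A.proj (nu + (rho / 4) • A.con v) - z.2), sq_nonneg (a - b)]
    have h9 : ‖A.proj (nu + (rho / 4) • A.con v) - z.2‖ ^ 2 / (2 * rho) ≤
        (a ^ 2 + b ^ 2) / rho := by
      rw [div_le_div_iff₀ (by positivity) hrho3]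
      nlinarith
    have h10 : γ * ‖v - u‖ ^ 2 + a ^ 2 / (2 * (rho / 4)) ≤ (a ^ 2 + b ^ 2) / rho := by linarith
    have h11 : a ^ 2 / (2 * (rho / 4)) = 2 * a ^ 2 / rho := by field_simp; ring
    rw [h11, le_div_iff₀ hrho3, add_mul, div_mul_cancel₀ _ hrho3.ne'] at h10
    nlinarith
  have hvu : ‖v - u‖ ≤ ‖z.2 - nu‖ := by
    refine le_of_sq_le_sq ?_ (norm_nonneg _)
    nlinarith [sq_nonneg ‖v - u‖, sq_nonneg ‖A.proj (nu + (rho / 4) • A.con v) - nu‖]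
  have hup : ‖A.proj (z.2 + rho • A.con v) - z.2‖ ≤ 8 * ‖z.2 - nu‖ := by
    refine le_of_sq_le_sq ?_ (by positivity)
    have := A.norm_proj_update_sub_sq_le hrho3 hz2 (mem_polar_of_mem_multipliers hnu) (A.con v)
    nlinarith [mul_nonneg (mul_nonneg hγ.le hrho3.le) (sq_nonneg ‖v - u‖)]
  refine ⟨v, hvu.trans hnl, ?_, ?_⟩
  · refine (hmin.isLocalMin ?_).hasFDerivAt_eq_zero (hderiv v hv)
    refine Metric.closedBall_mem_nhds_of_mem ?_
    rw [Metric.mem_ball, dist_eq_norm]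
    exact (hvu.trans hnl).trans_lt (hz1.trans_le (min_le_right _ _))
  · have := norm_sub_le_norm_sub_add_norm_sub v u z.1
    rw [norm_sub_rev u] at this
    linarith

end SOSC

end ConeProgram

/-! ### Abstract inexact iterations -/

section InexactIteration

variable {Z : Type*} [NormedAddCommGroup Z] {σ : Z → ℝ} {psi : ℝ → ℝ} {c L δ δ₁ ε : ℝ} {zS : Z}
  {rho : ℕ → ℝ} {z : ℕ → Z}

theorem exists_le_mul_of_tendsto_div (hpsi : Tendsto (fun t => psi t / t) (𝓝[>] 0) (𝓝 0)) {η : ℝ}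
    (hη : 0 < η) : ∃ δ > 0, ∀ t, 0 < t → t < δ → psi t ≤ η * t := by
  have h1 := hpsi.eventually (gt_mem_nhds hη)
  rw [eventually_nhdsWithin_iff] at h1
  obtain ⟨δ, hδ, h2⟩ := Metric.eventually_nhds_iff.1 h1
  refine ⟨δ, hδ, fun t ht htδ => ?_⟩
  have := h2 (y := t) (by rwa [Real.dist_eq, sub_zero, abs_of_pos ht]) ht
  rw [div_lt_iff₀ ht] at this
  exact this.le

/-- An iteration whose steps are bounded by the residual `σ`, and which reduces the residual near
`zS`, stays near `zS` and halves the residual in every step. -/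
theorem iteration_localized (hσ : ∀ a, 0 ≤ σ a) (hS : σ zS = 0) (hL : 0 ≤ L)
    (hlip : ∀ a ∈ Metric.closedBall zS δ, ∀ b ∈ Metric.closedBall zS δ, |σ a - σ b| ≤ L * ‖a - b‖)
    (hc : 0 < c) (hpsi : ∀ t, 0 < t → t < δ₁ → psi t ≤ 1 / 4 * t) (hε : (1 + 2 * c * L) * ε ≤ δ)
    (hε' : L * ε < δ₁) (h0 : ‖z 0 - zS‖ ≤ ε) (hrho : ∀ k, 4 * c ≤ rho k) {N : ℕ}
    (hstep : ∀ k < N, ‖z (k + 1) - z k‖ ≤ c * σ (z k))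
    (hdec : ∀ k < N, z k ∈ Metric.closedBall zS δ → z (k + 1) ∈ Metric.closedBall zS δ →
      σ (z (k + 1)) ≤ psi (σ (z k)) + c * σ (z k) / rho k) :
    ∀ k ≤ N, z k ∈ Metric.closedBall zS δ ∧ ‖z k - z 0‖ + 2 * c * σ (z k) ≤ 2 * c * σ (z 0) ∧
      σ (z k) ≤ σ (z 0) ∧ ∀ j < k, σ (z (j + 1)) ≤ σ (z j) / 2 := by
  have hε0 : 0 ≤ ε := (norm_nonneg _).trans h0
  have hcL : 0 ≤ 2 * c * L * ε := by positivity
  have hSB : zS ∈ Metric.closedBall zS δ := Metric.mem_closedBall_self (by nlinarith)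
  have h0B : z 0 ∈ Metric.closedBall zS δ := by
    rw [Metric.mem_closedBall, dist_eq_norm]; nlinarith
  have hσ0 : σ (z 0) ≤ L * ε := by
    have h1 := hlip _ h0B _ hSB
    rw [hS, sub_zero, abs_of_nonneg (hσ _)] at h1
    exact h1.trans (mul_le_mul_of_nonneg_left h0 hL)
  intro k
  -- The distance bound telescopes: a step costs at most `c * σ`, and halving the residual releases
  -- exactly that much from `2 * c * σ`. So the iterates stay within `2 * c * L * ε` of `z 0`.
  induction k with
  | zero => intro _; exact ⟨h0B, by simp, le_rfl, fun j hj => absurd hj (Nat.not_lt_zero j)⟩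
  | succ k ih =>
    intro hk
    have hkN : k < N := hk
    obtain ⟨hB, hd, hle, hhalf⟩ := ih hkN.le
    have hs := hstep k hkN
    have hσk := hσ (z k)
    have htri := norm_sub_le_norm_sub_add_norm_sub (z (k + 1)) (z k) (z 0)
    have hmv : c * σ (z 0) ≤ c * (L * ε) := mul_le_mul_of_nonneg_left hσ0 hc.le
    have hB' : z (k + 1) ∈ Metric.closedBall zS δ := by
      rw [Metric.mem_closedBall, dist_eq_norm]
      have := norm_sub_le_norm_sub_add_norm_sub (z (k + 1)) (z 0) zS
      nlinarith [mul_nonneg hc.le hσk]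
    have hh : σ (z (k + 1)) ≤ σ (z k) / 2 := by
      -- Nothing bounds `psi` above at zero; there the step bound itself forces `z (k + 1) = z k`.
      rcases eq_or_lt_of_le hσk with h1 | h1
      · rw [← h1, mul_zero] at hs
        rw [sub_eq_zero.1 (norm_eq_zero.1 (le_antisymm hs (norm_nonneg _)))]
        linarith
      · have h2 := hdec k hkN hB hB'
        have h3 := hpsi _ h1 (by linarith)
        have h4 : c * σ (z k) / rho k ≤ σ (z k) / 4 := by
          have := hrho k
          rw [div_le_div_iff₀ (by linarith) four_pos]
          nlinarith
        linarith
    refine ⟨hB', ?_, by linarith, fun j hj => ?_⟩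
    · have := mul_le_mul_of_nonneg_left hh hc.le
      linarith
    · rcases Nat.lt_succ_iff_lt_or_eq.1 hj with h1 | h1
      · exact hhalf j h1
      · rw [h1]; exact hh

/-- Convergence and rate of convergence of an iteration as in `iteration_localized`. -/
theorem iteration_converges [CompleteSpace Z] (hσ : ∀ a, 0 ≤ σ a) (hS : σ zS = 0) (hL : 0 < L)
    (hlip : ∀ a ∈ Metric.closedBall zS δ, ∀ b ∈ Metric.closedBall zS δ, |σ a - σ b| ≤ L * ‖a - b‖)
    (hc : 0 < c) (hpsi₀ : Tendsto (fun t => psi t / t) (𝓝[>] 0) (𝓝 0))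
    (hpsi : ∀ t, 0 < t → t < δ₁ → psi t ≤ 1 / 4 * t) (hε : (1 + 2 * c * L) * ε ≤ δ)
    (hε' : L * ε < δ₁) (h0 : ‖z 0 - zS‖ ≤ ε) (hrho : ∀ k, 4 * c ≤ rho k)
    (hstep : ∀ k, ‖z (k + 1) - z k‖ ≤ c * σ (z k))
    (hdec : ∀ k, z k ∈ Metric.closedBall zS δ → z (k + 1) ∈ Metric.closedBall zS δ →
      σ (z (k + 1)) ≤ psi (σ (z k)) + c * σ (z k) / rho k) :
    ∃ a ∈ Metric.closedBall zS δ, σ a = 0 ∧ Tendsto z atTop (𝓝 a) ∧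
      ∀ t > 0, (∀ᶠ k in atTop, 4 * c ^ 2 * L / t ≤ rho k) →
        ∀ᶠ k in atTop, ‖z (k + 1) - a‖ ≤ t * ‖z k - a‖ := by
  have hloc := fun N => iteration_localized hσ hS hL.le hlip hc hpsi hε hε' h0 hrho (N := N)
    (fun k _ => hstep k) (fun k _ => hdec k)
  have hB : ∀ k, z k ∈ Metric.closedBall zS δ := fun k => (hloc k k le_rfl).1
  have hhalf : ∀ k, σ (z (k + 1)) ≤ σ (z k) / 2 := fun k =>
    (hloc (k + 1) (k + 1) le_rfl).2.2.2 k (Nat.lt_succ_self k)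
  have hgeo : ∀ j k, σ (z (j + k)) ≤ σ (z j) * (1 / 2) ^ k := by
    intro j k
    induction k with
    | zero => simp
    | succ k ih =>
      have := hhalf (j + k)
      rw [pow_succ, ← add_assoc]
      linarith
  have hdist : ∀ j k, dist (z (j + k)) (z (j + (k + 1))) ≤ c * σ (z j) * (1 / 2) ^ k := by
    intro j k
    rw [dist_comm, dist_eq_norm, mul_assoc]
    exact (hstep (j + k)).trans (mul_le_mul_of_nonneg_left (hgeo j k) hc.le)
  obtain ⟨a, ha⟩ := cauchySeq_tendsto_of_complete (cauchySeq_of_le_geometric (1 / 2)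
    (c * σ (z 0)) (by norm_num) fun k => by simpa using hdist 0 k)
  have haB : a ∈ Metric.closedBall zS δ :=
    Metric.isClosed_closedBall.mem_of_tendsto ha (Eventually.of_forall hB)
  have hlim : ∀ j, ‖z j - a‖ ≤ 2 * c * σ (z j) := by
    intro j
    have h1 : Tendsto (fun k => z (j + k)) atTop (𝓝 a) := by
      simpa [add_comm] using (tendsto_add_atTop_iff_nat j).2 ha
    have := dist_le_of_le_geometric_of_tendsto (1 / 2) (c * σ (z j)) (by norm_num) (hdist j) h1 0
    rw [add_zero, dist_eq_norm] at this
    exact this.trans_eq (by ring)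
  have hnorm : Tendsto (fun k => L * ‖z k - a‖) atTop (𝓝 0) := by
    simpa using (tendsto_iff_norm_sub_tendsto_zero.1 ha).const_mul L
  have hσz : Tendsto (fun k => σ (z k)) atTop (𝓝 0) := by
    refine squeeze_zero (fun k => hσ _) (fun k => ?_)
      (g := fun k : ℕ => σ (z 0) * (1 / 2 : ℝ) ^ k) ?_
    · simpa using hgeo 0 k
    · simpa using (tendsto_pow_atTop_nhds_zero_of_lt_one (r := (1 / 2 : ℝ)) (by norm_num)
        (by norm_num)).const_mul (σ (z 0))
  have hσa : σ a = 0 := by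
    have h1 : Tendsto (fun k => σ (z k) + L * ‖z k - a‖) atTop (𝓝 0) := by
      simpa using hσz.add hnorm
    refine le_antisymm (ge_of_tendsto h1 (Eventually.of_forall fun k => ?_)) (hσ a)
    have := neg_le_of_abs_le (hlip _ (hB k) _ haB)
    linarith
  refine ⟨a, haB, hσa, ha, fun t ht hrt => ?_⟩
  -- The quotient `t` is shared equally by `psi` and `1 / rho`, each contributing `t / (4 * c * L)`
  -- times the residual; the factors `2 * c` from `hlim` and `L` from the Lipschitz bound restore
  -- `t`.
  obtain ⟨δ₂, hδ₂, hpsi₂⟩ := exists_le_mul_of_tendsto_div hpsi₀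
    (by positivity : 0 < t / (4 * c * L))
  filter_upwards [hrt, hσz.eventually (gt_mem_nhds hδ₂)] with k hk1 hk2
  have h1 := hlim (k + 1)
  rcases eq_or_lt_of_le (hσ (z k)) with h2 | h2
  · have h3 := hhalf k
    rw [← h2] at h3
    have : 0 ≤ t * ‖z k - a‖ := by positivity
    nlinarith
  · have h3 := hdec k (hB k) (hB (k + 1))
    have h4 := hpsi₂ _ h2 hk2
    have hr0 : 0 < rho k := by linarith [hrho k]
    have h5 : c * σ (z k) / rho k ≤ t / (4 * c * L) * σ (z k) := by
      rw [div_mul_eq_mul_div, div_le_div_iff₀ hr0 (by positivity)]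
      rw [div_le_iff₀ ht] at hk1
      nlinarith
    have h6 : σ (z k) ≤ L * ‖z k - a‖ := by
      have := hlip _ (hB k) _ haB
      rwa [hσa, sub_zero, abs_of_nonneg (hσ _)] at this
    calc ‖z (k + 1) - a‖ ≤ 2 * c * σ (z (k + 1)) := h1
      _ ≤ 2 * c * (t / (4 * c * L) * σ (z k) + t / (4 * c * L) * σ (z k)) := by
        gcongr; linarith
      _ = t / L * σ (z k) := by field_simp; ring
      _ ≤ t / L * (L * ‖z k - a‖) := by gcongr
      _ = t * ‖z k - a‖ := by field_simp

end InexactIteration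

/-! ### Reduction of (FP) to a cone program -/

namespace Bilevel

section Coordinates

variable {n m p q r s : ℕ}

/-- `xyOf` as a continuous linear map. -/
def xyCLM : Prim n m r s →L[ℝ] E n × E m :=
  LinearMap.toContinuousLinearMap
    { toFun := xyOf
      map_add' := fun _ _ => rfl
      map_smul' := fun _ _ => rfl }

theorem contDiff_xyOf {k : WithTop ℕ∞} : ContDiff ℝ k (xyOf : Prim n m r s → E n × E m) :=
  (xyCLM (n := n) (m := m) (r := r) (s := s)).contDiff

theorem hasFDerivAt_comp_xyOf {X : Type*} [NormedAddCommGroup X] [NormedSpace ℝ X]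
    {f : E n × E m → X} {u : Prim n m r s} (hf : DifferentiableAt ℝ f (xyOf u)) :
    HasFDerivAt (fun v => f (xyOf v)) (fderiv ℝ f (xyOf u) ∘L xyCLM) u :=
  HasFDerivAt.comp u hf.hasFDerivAt (xyCLM (n := n) (m := m) (r := r) (s := s)).hasFDerivAt

theorem inner_dual_eq (a b : Dual m p q r s) :
    inner ℝ a b = inner ℝ (lamH a) (lamH b) + inner ℝ (lamG a) (lamG b) +
      inner ℝ (lamL a) (lamL b) + inner ℝ (lamh a) (lamh b) + inner ℝ (lamg a) (lamg b) := by
  simp only [PiLp.inner_apply, Fintype.sum_sum_type, lamH, lamG, lamL, lamh, lamg]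
  ring

end Coordinates

section PartialGradient

variable {n m : ℕ}

theorem differentiableAt_partial {φ : E n × E m → ℝ} {z : E n × E m}
    (h : DifferentiableAt ℝ φ z) : DifferentiableAt ℝ (fun y => φ (z.1, y)) z.2 :=
  DifferentiableAt.comp (g := φ) (f := fun y => (z.1, y)) z.2 h (by fun_prop)

theorem gradY_add {φ χ : E n × E m → ℝ} {z : E n × E m} (hφ : DifferentiableAt ℝ φ z)
    (hχ : DifferentiableAt ℝ χ z) :
    gradY (fun w => φ w + χ w) z = gradY φ z + gradY χ z := by
  simp only [gradY, gradient]
  rw [← map_add, ← fderiv_fun_add (differentiableAt_partial hφ) (differentiableAt_partial hχ)]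

theorem gradY_sum_const_mul {k : ℕ} {φ : Fin k → E n × E m → ℝ} {z : E n × E m} (a : Fin k → ℝ)
    (hφ : ∀ i, DifferentiableAt ℝ (φ i) z) :
    gradY (fun w => ∑ i, a i * φ i w) z = ∑ i, a i • gradY (φ i) z := by
  simp only [gradY, gradient]
  rw [fderiv_fun_sum fun i _ => (differentiableAt_partial (hφ i)).const_mul (a i), map_sum]
  refine Finset.sum_congr rfl fun i _ => ?_
  rw [fderiv_const_mul (differentiableAt_partial (hφ i))]
  exact map_smul (InnerProductSpace.toDual ℝ (E m)).symm (a i) _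

end PartialGradient

namespace Problem

variable {n m p q r s : ℕ} (P : Problem n m p q r s)

/-- The first-order reformulation (FP) as a cone program. -/
def toCone : ConeProgram (Prim n m r s) (Fin p ⊕ Fin q ⊕ Fin m ⊕ Fin r ⊕ Fin s) where
  obj u := P.F (xyOf u)
  con := P.Gtilde
  ineq := Set.range fun i => Sum.inr (Sum.inl i)

theorem toCone_proj (lam : Dual m p q r s) : P.toCone.proj lam = projPolar lam := by
  ext i
  rcases i with i | i | i | i | i <;>
    simp [ConeProgram.proj, toCone, projPolar, lamH, lamG, lamL, lamh, lamg]

theorem toCone_polar : P.toCone.polar = polarCone m p q r s := by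
  ext lam
  simp [ConeProgram.polar, toCone, polarCone, lamG]

theorem lag_eq (u : Prim n m r s) (lam : Dual m p q r s) : P.lag u lam = P.toCone.lagr u lam := by
  rw [ConeProgram.lagr, inner_dual_eq, lag]
  simp only [← add_assoc]
  rfl

theorem augLag_eq (rho : ℝ) (u : Prim n m r s) (lam : Dual m p q r s) :
    P.augLag rho u lam = P.toCone.aug rho u lam := by
  simp only [augLag, ConeProgram.aug, Fintype.sum_sum_type, PiLp.inner_apply,
    EuclideanSpace.norm_sq_eq, Real.norm_eq_abs, sq_abs]
  simp [toCone, Gtilde, posPart, lamH, lamG, lamL, lamh, lamg, Finset.sum_add_distrib,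
    Finset.mul_sum, ← Finset.sum_sub_distrib, div_eq_inv_mul, mul_comm]
  ring

section Smoothness

variable {P}

/-- This formula, linear in `μ` and `ξ`, gives access to the assumed smoothness of the partial
gradients; twice differentiable data alone would leave `stat` only once differentiable. -/
theorem SmoothAround.eventually_stat_eq {u : Prim n m r s} (h : P.SmoothAround (xyOf u)) :
    P.stat =ᶠ[𝓝 u] fun v => gradY P.f (xyOf v) +
      ∑ j, muOf v j • gradY (fun w => P.h w j) (xyOf v) +
      ∑ i, xiOf v i • gradY (fun w => P.g w i) (xyOf v) := by
  obtain ⟨-, -, -, hf, hh, hg, -⟩ := h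
  have hxy : Tendsto (xyOf : Prim n m r s → E n × E m) (𝓝 u) (𝓝 (xyOf u)) :=
    (contDiff_xyOf (k := 0)).continuous.tendsto u
  filter_upwards [hxy.eventually (hf.eventually (by simp)),
    hxy.eventually (hh.eventually (by simp)), hxy.eventually (hg.eventually (by simp))]
    with v h1 h2 h3
  have h1 := h1.differentiableAt (by norm_num)
  have h2 : ∀ j, DifferentiableAt ℝ (fun w => P.h w j) (xyOf v) := fun j =>
    (contDiffAt_euclidean.1 h2 j).differentiableAt (by norm_num)
  have h3 : ∀ i, DifferentiableAt ℝ (fun w => P.g w i) (xyOf v) := fun i =>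
    (contDiffAt_euclidean.1 h3 i).differentiableAt (by norm_num)
  have e : (fun w => P.lowerLag w (muOf v) (xiOf v)) = fun w =>
      P.f w + ∑ j, muOf v j * P.h w j + ∑ i, xiOf v i * P.g w i := by
    funext w
    simp only [lowerLag, ConeProgram.inner_eq_sum]
  have h4 : DifferentiableAt ℝ (fun w => ∑ j, muOf v j * P.h w j) (xyOf v) :=
    DifferentiableAt.fun_sum fun j _ => (h2 j).const_mul _
  have h5 : DifferentiableAt ℝ (fun w => ∑ i, xiOf v i * P.g w i) (xyOf v) :=
    DifferentiableAt.fun_sum fun j _ => (h3 j).const_mul _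
  rw [stat, gradLowerLag, e, gradY_add (h1.fun_add h4) h5, gradY_add h1 h4,
    gradY_sum_const_mul _ h2, gradY_sum_const_mul _ h3]

theorem SmoothAround.contDiffAt_stat {u : Prim n m r s} (h : P.SmoothAround (xyOf u)) :
    ContDiffAt ℝ 2 P.stat u := by
  refine ContDiffAt.congr_of_eventuallyEq ?_ h.eventually_stat_eq
  obtain ⟨-, -, -, -, -, -, hf, hh, hg⟩ := h
  have hxy : ContDiffAt ℝ 2 (xyOf : Prim n m r s → E n × E m) u := contDiff_xyOf.contDiffAt
  have hmu : ∀ j, ContDiffAt ℝ 2 (fun v : Prim n m r s => muOf v j) u := fun j => by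
    simp only [muOf]; fun_prop
  have hxi : ∀ i, ContDiffAt ℝ 2 (fun v : Prim n m r s => xiOf v i) u := fun i => by
    simp only [xiOf]; fun_prop
  exact ((hf.comp u hxy).add (ContDiffAt.sum fun j _ => (hmu j).smul ((hh j).comp u hxy))).add
    (ContDiffAt.sum fun i _ => (hxi i).smul ((hg i).comp u hxy))

/-- Strict complementarity keeps `g i + ξ i` away from the kink of the projection: nearby, an active
component equals `g i` and an inactive one `-ξ i`. -/
theorem contDiffAt_compl {u : Prim n m r s} (h : P.SmoothAround (xyOf u))
    (hk : P.LowerKKT (xyOf u) (muOf u) (xiOf u)) (hs : ∀ i, 0 < xiOf u i - P.g (xyOf u) i) :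
    ContDiffAt ℝ 2 P.compl u := by
  obtain ⟨-, -, hxi0, hg0, hcomp⟩ := hk
  have hxy : ContDiffAt ℝ 2 (xyOf : Prim n m r s → E n × E m) u := contDiff_xyOf.contDiffAt
  have hg : ∀ i, ContDiffAt ℝ 2 (fun v : Prim n m r s => P.g (xyOf v) i) u := fun i =>
    contDiffAt_euclidean.1 (h.2.2.2.2.2.1.comp u hxy) i
  have hxi : ∀ i, ContDiffAt ℝ 2 (fun v : Prim n m r s => xiOf v i) u := fun i => by
    simp only [xiOf]; fun_prop
  rw [contDiffAt_euclidean]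
  intro i
  have hsum : ContinuousAt (fun v : Prim n m r s => P.g (xyOf v) i + xiOf v i) u :=
    ((hg i).add (hxi i)).continuousAt
  have happ : ∀ v : Prim n m r s,
      P.compl v i = P.g (xyOf v) i - min (P.g (xyOf v) i + xiOf v i) 0 := fun _ => rfl
  rcases eq_or_lt_of_le (hg0 i) with h0 | h0
  · refine (hg i).congr_of_eventuallyEq ?_
    have h1 : 0 < P.g (xyOf u) i + xiOf u i := by linarith [hs i]
    filter_upwards [hsum.eventually (lt_mem_nhds h1)] with v hv
    rw [happ, min_eq_right hv.le, sub_zero]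
  · refine (hxi i).neg.congr_of_eventuallyEq ?_
    have h1 : xiOf u i = 0 := by
      rw [ConeProgram.inner_eq_sum, Finset.sum_eq_zero_iff_of_nonpos fun j _ =>
        mul_nonpos_of_nonneg_of_nonpos (hxi0 j) (hg0 j)] at hcomp
      exact (mul_eq_zero.1 (hcomp i (Finset.mem_univ i))).resolve_right h0.ne
    have h2 : P.g (xyOf u) i + xiOf u i < 0 := by linarith
    filter_upwards [hsum.eventually (gt_mem_nhds h2)] with v hv
    rw [happ, min_eq_left hv.le]
    ring

theorem contDiffAt_Gtilde {u : Prim n m r s} (h : P.SmoothAround (xyOf u))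
    (hc : ContDiffAt ℝ 2 P.compl u) : ContDiffAt ℝ 2 P.Gtilde u := by
  have hxy : ContDiffAt ℝ 2 (xyOf : Prim n m r s → E n × E m) u := contDiff_xyOf.contDiffAt
  have hst := h.contDiffAt_stat
  obtain ⟨-, hH, hG, -, hh, -⟩ := h
  rw [contDiffAt_euclidean]
  rintro (i | i | i | i | i)
  · exact contDiffAt_euclidean.1 (hH.comp u hxy) i
  · exact contDiffAt_euclidean.1 (hG.comp u hxy) i
  · exact contDiffAt_euclidean.1 hst i
  · exact contDiffAt_euclidean.1 (hh.comp u hxy) i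
  · exact contDiffAt_euclidean.1 hc i

end Smoothness

section Gradients

variable {P}

theorem gradLag_eq {u : Prim n m r s} (ho : DifferentiableAt ℝ P.toCone.obj u)
    (hc : DifferentiableAt ℝ P.toCone.con u) (lam : Dual m p q r s) :
    P.gradLag u lam = (InnerProductSpace.toDual ℝ (Prim n m r s)).symm
      (P.toCone.dLag (u, lam)) := by
  simp only [gradLag, gradient, lag_eq]
  rw [(P.toCone.hasFDerivAt_lagr ho hc lam).fderiv]

theorem norm_gradLag {u : Prim n m r s} (ho : DifferentiableAt ℝ P.toCone.obj u)
    (hc : DifferentiableAt ℝ P.toCone.con u) (lam : Dual m p q r s) :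
    ‖P.gradLag u lam‖ = ‖P.toCone.dLag (u, lam)‖ := by
  rw [gradLag_eq ho hc, LinearIsometryEquiv.norm_map]

theorem hasFDerivAt_augLag {rho : ℝ} (hrho : 0 < rho) {u : Prim n m r s}
    (ho : DifferentiableAt ℝ P.toCone.obj u) (hc : DifferentiableAt ℝ P.toCone.con u)
    (lam : Dual m p q r s) :
    HasFDerivAt (fun v => P.augLag rho v lam)
      (P.toCone.dLag (u, projPolar (lam + rho • P.Gtilde u))) u := by
  simp only [augLag_eq, ← P.toCone_proj]
  exact P.toCone.hasFDerivAt_aug hrho ho hc lam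

theorem gradient_augLag {rho : ℝ} (hrho : 0 < rho) {u : Prim n m r s}
    (ho : DifferentiableAt ℝ P.toCone.obj u) (hc : DifferentiableAt ℝ P.toCone.con u)
    (lam : Dual m p q r s) :
    gradient (fun v => P.augLag rho v lam) u =
      P.gradLag u (projPolar (lam + rho • P.Gtilde u)) := by
  rw [gradLag_eq ho hc, gradient, (hasFDerivAt_augLag hrho ho hc lam).fderiv]

end Gradients

/-- The Riesz isometry is a fixed linear map, so it commutes with differentiation and cancels
against the inner product. -/
theorem hessQuad_eq {V : Type*} [NormedAddCommGroup V] [InnerProductSpace ℝ V] [CompleteSpace V]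
    {φ : V → ℝ} {φ' : V → V →L[ℝ] ℝ} {φ'' : V →L[ℝ] V →L[ℝ] ℝ} {a : V}
    (h1 : ∀ᶠ v in 𝓝 a, HasFDerivAt φ (φ' v) v) (h2 : HasFDerivAt φ' φ'' a) (d : V) :
    hessQuad φ a d = φ'' d d := by
  have e : gradient φ =ᶠ[𝓝 a] fun v => (InnerProductSpace.toDual ℝ V).symm (φ' v) := by
    filter_upwards [h1] with v hv
    rw [gradient, hv.fderiv]
  let ℓ : (V →L[ℝ] ℝ) ≃ₗᵢ[ℝ] V := (InnerProductSpace.toDual ℝ V).symm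
  have h3 : HasFDerivAt (fun v => ℓ (φ' v)) ((ℓ : (V →L[ℝ] ℝ) →L[ℝ] V) ∘L φ'') a :=
    ℓ.hasFDerivAt.comp a h2
  rw [hessQuad, (h3.congr_of_eventuallyEq e).fderiv]
  exact InnerProductSpace.toDual_symm_apply

section Conditions

variable {P}

theorem mem_toCone_multipliers {u : Prim n m r s} (ho : DifferentiableAt ℝ P.toCone.obj u)
    (hc : DifferentiableAt ℝ P.toCone.con u) {lam : Dual m p q r s} :
    lam ∈ P.multipliers u ↔ lam ∈ P.toCone.multipliers u ∧ P.toCone.Feasible u := by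
  rw [multipliers, ConeProgram.multipliers, ConeProgram.Feasible, Set.mem_ofPred_eq,
    Set.mem_ofPred_eq, gradLag_eq ho hc, map_eq_zero_iff _ (LinearIsometryEquiv.injective _)]
  constructor
  · rintro ⟨h1, h2, ⟨h3, h4, h5⟩, h6, h7, h8⟩
    rw [ConeProgram.inner_eq_sum, Finset.sum_eq_zero_iff_of_nonpos fun j _ =>
      mul_nonpos_of_nonneg_of_nonpos (h3 j) (h4 j)] at h5
    refine ⟨⟨h1, ?_⟩, ?_, ?_⟩
    · rintro _ ⟨i, rfl⟩
      exact ⟨h3 i, h5 i (Finset.mem_univ i)⟩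
    · rintro _ ⟨i, rfl⟩
      exact h4 i
    · rintro (i | i | i | i | i) hi
      · exact congrArg (fun w : E p => w i) h2
      · exact absurd ⟨i, rfl⟩ hi
      · exact congrArg (fun w : E m => w i) h6
      · exact congrArg (fun w : E r => w i) h7
      · exact congrArg (fun w : E s => w i) h8
  · rintro ⟨⟨h1, h2⟩, h3, h4⟩
    refine ⟨h1, ?_, ⟨fun i => (h2 _ ⟨i, rfl⟩).1, fun i => h3 _ ⟨i, rfl⟩, ?_⟩, ?_, ?_, ?_⟩
    · ext i; exact h4 (Sum.inl i) (by simp [toCone])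
    · rw [ConeProgram.inner_eq_sum]
      exact Finset.sum_eq_zero fun i _ => (h2 _ ⟨i, rfl⟩).2
    · ext i; exact h4 (Sum.inr (Sum.inr (Sum.inl i))) (by simp [toCone])
    · ext i; exact h4 (Sum.inr (Sum.inr (Sum.inr (Sum.inl i)))) (by simp [toCone])
    · ext i; exact h4 (Sum.inr (Sum.inr (Sum.inr (Sum.inr i)))) (by simp [toCone])

theorem fderiv_euclidean_apply {V ι : Type*} [Fintype ι] [NormedAddCommGroup V] [NormedSpace ℝ V]
    {f : V → EuclideanSpace ℝ ι} {a : V} (hf : DifferentiableAt ℝ f a) (d : V) (i : ι) :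
    fderiv ℝ f a d i = fderiv ℝ (fun v => f v i) a d := by
  have : HasFDerivAt (fun v => f v i) (EuclideanSpace.proj i ∘L fderiv ℝ f a : V →L[ℝ] ℝ) a :=
    (EuclideanSpace.proj (𝕜 := ℝ) i : EuclideanSpace ℝ ι →L[ℝ] ℝ).hasFDerivAt.comp a hf.hasFDerivAt
  rw [this.fderiv]
  rfl

/-- The chain rule through `xyOf` matches the blocks of the critical cone of (FP) with the
coordinates of the derivative of `Gtilde`; the Hessian forms agree by `hessQuad_eq`. -/
theorem SOSC.toCone {u : Prim n m r s} {lam : Dual m p q r s} (h : P.SOSC u lam)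
    (hsm : P.SmoothAround (xyOf u)) (hcompl : ContDiffAt ℝ 2 P.compl u) :
    P.toCone.SOSC u lam := by
  have hxy : ContDiffAt ℝ 2 (xyOf : Prim n m r s → E n × E m) u := contDiff_xyOf.contDiffAt
  have hos : ContDiffAt ℝ 2 P.toCone.obj u := hsm.1.comp u hxy
  have hcs : ContDiffAt ℝ 2 P.toCone.con u := contDiffAt_Gtilde hsm hcompl
  have ho := hos.differentiableAt (by norm_num)
  have hc := hcs.differentiableAt (by norm_num)
  obtain ⟨hmem, hpos⟩ := h
  have hmem' := (mem_toCone_multipliers ho hc).1 hmem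
  refine ⟨hos, hcs, hmem'.2, hmem'.1, fun d hd h1 h2 h3 => ?_⟩
  have hblock : ∀ {k : ℕ} {φ : E n × E m → E k}, DifferentiableAt ℝ φ (xyOf u) → ∀ i,
      fderiv ℝ φ (xyOf u) (xyOf d) i = fderiv ℝ (fun v : Prim n m r s => φ (xyOf v) i) u d := by
    intro k φ hφ i
    rw [← fderiv_euclidean_apply (hasFDerivAt_comp_xyOf hφ).differentiableAt,
      (hasFDerivAt_comp_xyOf hφ).fderiv]
    rfl
  have hcon := fun i => fderiv_euclidean_apply hc d i
  have hcrit : d ∈ P.criticalCone u := by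
    refine ⟨fun i hi => ?_, ⟨?_, ?_, ?_, ?_⟩, ?_⟩
    · rw [hblock (hsm.2.2.1.differentiableAt (by norm_num))]
      have := h2 (Sum.inr (Sum.inl i)) ⟨i, rfl⟩ hi
      rwa [hcon] at this
    · ext i
      rw [hblock (hsm.2.1.differentiableAt (by norm_num))]
      have := h1 (Sum.inl i) (by simp [Problem.toCone])
      rwa [hcon] at this
    · ext i
      rw [fderiv_euclidean_apply (hsm.contDiffAt_stat.differentiableAt (by norm_num))]
      have := h1 (Sum.inr (Sum.inr (Sum.inl i))) (by simp [Problem.toCone])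
      rwa [hcon] at this
    · ext i
      rw [hblock (hsm.2.2.2.2.1.differentiableAt (by norm_num))]
      have := h1 (Sum.inr (Sum.inr (Sum.inr (Sum.inl i)))) (by simp [Problem.toCone])
      rwa [hcon] at this
    · ext i
      rw [fderiv_euclidean_apply (hcompl.differentiableAt (by norm_num))]
      have := h1 (Sum.inr (Sum.inr (Sum.inr (Sum.inr i)))) (by simp [Problem.toCone])
      rwa [hcon] at this
    · have : HasFDerivAt P.toCone.obj (fderiv ℝ P.F (xyOf u) ∘L xyCLM) u :=
        hasFDerivAt_comp_xyOf (hsm.1.differentiableAt (by norm_num))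
      rw [this.fderiv] at h3
      exact h3
  have hfin := hpos d hcrit hd
  have hlag : ∀ᶠ v in 𝓝 u, HasFDerivAt (fun v => P.lag v lam) (P.toCone.dLag (v, lam)) v := by
    filter_upwards [ConeProgram.eventually_differentiableAt hos hcs] with v hv
    simp only [lag_eq]
    exact P.toCone.hasFDerivAt_lagr hv.1 hv.2 lam
  have hd1 : HasFDerivAt P.toCone.dLag (fderiv ℝ P.toCone.dLag (u, lam)) (u, lam) :=
    ((ConeProgram.contDiffAt_dLag hos hcs lam).differentiableAt (by norm_num)).hasFDerivAt
  have hd2 : HasFDerivAt (fun v => P.toCone.dLag (v, lam))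
      (fderiv ℝ P.toCone.dLag (u, lam) ∘L ContinuousLinearMap.inl ℝ _ _) u :=
    HasFDerivAt.comp (g := P.toCone.dLag) u hd1 (hasFDerivAt_prodMk_left u lam)
  rwa [hessQuad_eq hlag hd2] at hfin

end Conditions

end Problem

end Bilevel

/-! ### The residual of (FP) along the method -/

namespace Bilevel

section Pair

variable {X Y : Type*} [NormedAddCommGroup X] [NormedAddCommGroup Y]

theorem norm_pair_sq (a : X) (b : Y) : ‖pair a b‖ ^ 2 = ‖a‖ ^ 2 + ‖b‖ ^ 2 :=
  WithLp.prod_norm_sq_eq_of_L2 _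

theorem norm_fst_le_norm_pair (a : X) (b : Y) : ‖a‖ ≤ ‖pair a b‖ :=
  le_of_sq_le_sq (by rw [norm_pair_sq]; nlinarith [sq_nonneg ‖b‖]) (norm_nonneg _)

theorem norm_snd_le_norm_pair (a : X) (b : Y) : ‖b‖ ≤ ‖pair a b‖ :=
  le_of_sq_le_sq (by rw [norm_pair_sq]; nlinarith [sq_nonneg ‖a‖]) (norm_nonneg _)

theorem norm_pair_le (a : X) (b : Y) : ‖pair a b‖ ≤ ‖a‖ + ‖b‖ :=
  le_of_sq_le_sq (by rw [norm_pair_sq]; nlinarith [norm_nonneg a, norm_nonneg b])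
    (by positivity)

end Pair

namespace Problem

variable {n m p q r s : ℕ} {P : Problem n m p q r s} {u uS : Prim n m r s}
  {lam lamS : Dual m p q r s}

theorem residual_nonneg (P : Problem n m p q r s) (u : Prim n m r s) (lam : Dual m p q r s) :
    0 ≤ P.residual u lam := norm_nonneg _

theorem res_le_residual (ho : DifferentiableAt ℝ P.toCone.obj u)
    (hc : DifferentiableAt ℝ P.toCone.con u) (lam : Dual m p q r s) :
    P.toCone.res u lam ≤ 2 * P.residual u lam := by
  have h1 := norm_fst_le_norm_pair (P.gradLag u lam) (lam - projPolar (lam + P.Gtilde u))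
  have h2 := norm_snd_le_norm_pair (P.gradLag u lam) (lam - projPolar (lam + P.Gtilde u))
  rw [ConeProgram.res, ← norm_gradLag ho hc, P.toCone_proj, residual]
  exact (add_le_add h1 h2).trans_eq (two_mul _).symm

/-- Near a point with smooth data the KKT residual is Lipschitz continuous. -/
theorem exists_lipschitz_residual (h : P.toCone.SOSC uS lamS) :
    ∃ δ > 0, ∃ L > 0,
      ∀ a ∈ Metric.closedBall (pair uS lamS) δ, ∀ b ∈ Metric.closedBall (pair uS lamS) δ,
        |P.residual a.fst a.snd - P.residual b.fst b.snd| ≤ L * ‖a - b‖ := by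
  obtain ⟨K₁, s₁, hs₁, hK₁⟩ := (ConeProgram.contDiffAt_dLag h.obj_smooth h.con_smooth
    lamS).exists_lipschitzOnWith
  obtain ⟨K₂, s₂, hs₂, hK₂⟩ := (h.con_smooth.of_le (m := 1) (by norm_num)).exists_lipschitzOnWith
  have hcont : Tendsto (fun a : WithLp 2 (Prim n m r s × Dual m p q r s) => (a.fst, a.snd))
      (𝓝 (pair uS lamS)) (𝓝 (uS, lamS)) :=
    (WithLp.prod_continuous_ofLp 2 _ _).tendsto (pair uS lamS)
  have hcont₁ : Tendsto (fun a : WithLp 2 (Prim n m r s × Dual m p q r s) => a.fst)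
      (𝓝 (pair uS lamS)) (𝓝 uS) := (continuous_fst.tendsto _).comp hcont
  have hev := (hcont.eventually_mem hs₁).and ((hcont₁.eventually_mem hs₂).and
    (hcont₁.eventually (ConeProgram.eventually_differentiableAt h.obj_smooth h.con_smooth)))
  obtain ⟨δ, hδ, hball⟩ := Metric.nhds_basis_closedBall.eventually_iff.1 hev
  -- The gradient contributes `K₁` and the complementarity block `2 + K₂`, the projection being
  -- nonexpansive; the final `1` is slack.
  refine ⟨δ, hδ, K₁ + (2 + K₂) + 1, by positivity, fun a ha b hb => ?_⟩
  obtain ⟨ha₁, ha₂, hoa, hca⟩ := hball ha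
  obtain ⟨hb₁, hb₂, hob, hcb⟩ := hball hb
  have hf : ‖a.fst - b.fst‖ ≤ ‖a - b‖ := norm_fst_le_norm_pair (a.fst - b.fst) (a.snd - b.snd)
  have hs : ‖a.snd - b.snd‖ ≤ ‖a - b‖ := norm_snd_le_norm_pair (a.fst - b.fst) (a.snd - b.snd)
  refine (abs_norm_sub_norm_le _ _).trans ((norm_pair_le
    (P.gradLag a.fst a.snd - P.gradLag b.fst b.snd)
    (a.snd - projPolar (a.snd + P.Gtilde a.fst) -
      (b.snd - projPolar (b.snd + P.Gtilde b.fst)))).trans ?_)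
  have h1 : ‖P.gradLag a.fst a.snd - P.gradLag b.fst b.snd‖ ≤ K₁ * ‖a - b‖ := by
    rw [gradLag_eq hoa hca, gradLag_eq hob hcb, ← map_sub, LinearIsometryEquiv.norm_map]
    have := hK₁.dist_le_mul _ ha₁ _ hb₁
    rw [dist_eq_norm, dist_eq_norm] at this
    exact this.trans (mul_le_mul_of_nonneg_left (norm_prod_le_iff.2 ⟨hf, hs⟩) K₁.2)
  have h2 : ‖P.Gtilde a.fst - P.Gtilde b.fst‖ ≤ K₂ * ‖a - b‖ := by
    have := hK₂.dist_le_mul _ ha₂ _ hb₂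
    rw [dist_eq_norm, dist_eq_norm] at this
    exact this.trans (mul_le_mul_of_nonneg_left hf K₂.2)
  have h3 : ‖projPolar (a.snd + P.Gtilde a.fst) - projPolar (b.snd + P.Gtilde b.fst)‖ ≤
      (1 + K₂) * ‖a - b‖ := by
    rw [← P.toCone_proj, ← P.toCone_proj]
    refine (P.toCone.norm_proj_sub_proj_le _ _).trans ?_
    rw [add_sub_add_comm]
    linarith [norm_add_le (a.snd - b.snd) (P.Gtilde a.fst - P.Gtilde b.fst)]
  have h4 : ‖a.snd - projPolar (a.snd + P.Gtilde a.fst) -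
      (b.snd - projPolar (b.snd + P.Gtilde b.fst))‖ ≤ ‖a - b‖ + (1 + K₂) * ‖a - b‖ := by
    rw [sub_sub_sub_comm]
    linarith [norm_sub_le (a.snd - b.snd)
      (projPolar (a.snd + P.Gtilde a.fst) - projPolar (b.snd + P.Gtilde b.fst))]
  linarith [norm_nonneg (a - b)]

/-- The residual after a step of the method. -/
theorem IsStep.residual_le {c rho eps : ℝ} {u' : Prim n m r s} {lam' : Dual m p q r s}
    (h : P.IsStep c rho eps u lam u' lam') (hrho : 0 < rho) (hlam : lam ∈ polarCone m p q r s)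
    (ho : DifferentiableAt ℝ P.toCone.obj u') (hc : DifferentiableAt ℝ P.toCone.con u') :
    P.residual u' lam' ≤ eps + c * P.residual u lam / rho := by
  obtain ⟨⟨-, h1⟩, h2, rfl⟩ := h
  rw [gradient_augLag hrho ho hc] at h1
  have h3 := P.toCone.norm_proj_update_le hrho (P.toCone_polar ▸ hlam) (P.Gtilde u')
  simp only [P.toCone_proj] at h3
  refine (norm_pair_le _ _).trans (add_le_add h1 (h3.trans ?_))
  exact div_le_div_of_nonneg_right ((norm_snd_le_norm_pair _ _).trans h2) hrho.le

theorem IsStep.mem_polarCone {c rho eps : ℝ} {u' : Prim n m r s} {lam' : Dual m p q r s}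
    (h : P.IsStep c rho eps u lam u' lam') : lam' ∈ polarCone m p q r s := by
  rw [h.2.2]; exact (projPolar_spec _).1

theorem IsStep.norm_sub_le {c rho eps : ℝ} {u' : Prim n m r s} {lam' : Dual m p q r s}
    (h : P.IsStep c rho eps u lam u' lam') :
    ‖pair u' lam' - pair u lam‖ ≤ c * P.residual u lam := by
  obtain ⟨-, h2, rfl⟩ := h
  exact h2

theorem residual_eq_zero (ho : DifferentiableAt ℝ P.toCone.obj u)
    (hc : DifferentiableAt ℝ P.toCone.con u) (h : lam ∈ P.multipliers u) :
    P.residual u lam = 0 := by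
  obtain ⟨hm, hf⟩ := (mem_toCone_multipliers ho hc).1 h
  have h1 := hf.proj_add_con hm
  rw [P.toCone_proj] at h1
  rw [residual, h.1]
  refine le_antisymm ((norm_pair_le _ _).trans_eq ?_) (norm_nonneg _)
  rw [norm_zero, zero_add, norm_eq_zero, sub_eq_zero]
  exact h1.symm

/-- The residual as a function of the pair `(u, lam)`. -/
def pairResidual (P : Problem n m p q r s) (a : WithLp 2 (Prim n m r s × Dual m p q r s)) : ℝ :=
  P.residual a.fst a.snd

end Problem

end Bilevel

end

/-! ### Assembly of the theorem -/

theorem mainTheorem8 {n m p q r s : ℕ} (P : Bilevel.Problem n m p q r s)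
    (uS : Bilevel.Prim n m r s) (lamS : Bilevel.Dual m p q r s)
    (hsmooth : P.SmoothAround (Bilevel.xyOf uS))
    (hjac : P.JacobianUniqueness (Bilevel.xyOf uS) (Bilevel.muOf uS) (Bilevel.xiOf uS))
    (hsosc : P.SOSC uS lamS)
    (psi : ℝ → ℝ) (hpsi_nonneg : ∀ t, 0 ≤ t → 0 ≤ psi t)
    (hpsi : Tendsto (fun t => psi t / t) (𝓝[>] 0) (𝓝 0)) :
    ∃ c₀ > 0, ∀ c ≥ c₀, ∃ epsBar > 0, ∃ rhoBar > 0,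
      -- (i) well-definedness: every partial run can be continued
      (∀ (rho : ℕ → ℝ) (u : ℕ → Bilevel.Prim n m r s) (lam : ℕ → Bilevel.Dual m p q r s) (N : ℕ),
        ‖Bilevel.pair (u 0 - uS) (lam 0 - lamS)‖ ≤ epsBar →
        lam 0 ∈ Bilevel.polarCone m p q r s → (∀ k, rhoBar ≤ rho k) →
        P.IsRun N psi c rho u lam →
        ∃ u' lam', P.IsStep c (rho N) (psi (P.residual (u N) (lam N))) (u N) (lam N) u' lam') ∧
      -- (i) convergence
      (∀ (rho : ℕ → ℝ) (u : ℕ → Bilevel.Prim n m r s) (lam : ℕ → Bilevel.Dual m p q r s),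
        ‖Bilevel.pair (u 0 - uS) (lam 0 - lamS)‖ ≤ epsBar →
        lam 0 ∈ Bilevel.polarCone m p q r s → (∀ k, rhoBar ≤ rho k) →
        P.IsRun ⊤ psi c rho u lam →
        ∃ lamBar ∈ P.multipliers uS,
          Tendsto (fun k => Bilevel.pair (u k) (lam k)) atTop (𝓝 (Bilevel.pair uS lamBar)) ∧
          -- (iii) Q-superlinear convergence
          (Tendsto rho atTop atTop →
            Bilevel.QSuperlinear (fun k => Bilevel.pair (u k) (lam k))
              (Bilevel.pair uS lamBar))) ∧
      -- (ii) Q-linear convergence with any prescribed quotient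
      (∀ t : ℝ, 0 < t → t < 1 → ∃ rhoT : ℝ,
        ∀ (rho : ℕ → ℝ) (u : ℕ → Bilevel.Prim n m r s) (lam : ℕ → Bilevel.Dual m p q r s),
          ‖Bilevel.pair (u 0 - uS) (lam 0 - lamS)‖ ≤ epsBar →
          lam 0 ∈ Bilevel.polarCone m p q r s → (∀ k, rhoBar ≤ rho k) → (∀ k, rhoT ≤ rho k) →
          P.IsRun ⊤ psi c rho u lam →
          ∃ lamBar ∈ P.multipliers uS,
            Bilevel.QLinear (fun k => Bilevel.pair (u k) (lam k)) (Bilevel.pair uS lamBar) t) := by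
  have hcone := hsosc.toCone hsmooth (Bilevel.Problem.contDiffAt_compl hsmooth hjac.1 hjac.2.2.1)
  have hdiff := ConeProgram.eventually_differentiableAt hcone.obj_smooth hcone.con_smooth
  obtain ⟨C₁, hC₁, hbound⟩ := hcone.exists_error_bound
  obtain ⟨C₂, hC₂, rho₀, hrho₀, hstat⟩ := hcone.exists_aug_stationary
  obtain ⟨δL, hδL, L, hL, hlip⟩ := Bilevel.Problem.exists_lipschitz_residual hcone
  obtain ⟨δ₁, hδ₁, hpsi₁⟩ := exists_le_mul_of_tendsto_div hpsi (by norm_num : (0 : ℝ) < 1 / 4)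
  obtain ⟨δd, hδd, hdiff⟩ := Metric.nhds_basis_closedBall.eventually_iff.1 hdiff
  -- a common neighbourhood
  have hev : ∀ᶠ a : WithLp 2 (Bilevel.Prim n m r s × Bilevel.Dual m p q r s) in
      𝓝 (Bilevel.pair uS lamS), a.snd ∈ P.toCone.polar →
      (‖a.fst - uS‖ ≤ C₁ * P.toCone.res a.fst a.snd ∧ ∃ nu ∈ P.toCone.multipliers uS,
        ‖a.snd - nu‖ ≤ ‖a.snd - lamS‖ ∧ ‖a.snd - nu‖ ≤ C₁ * P.toCone.res a.fst a.snd) ∧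
      ∀ rho ≥ rho₀, ∃ v, ‖v - uS‖ ≤ ‖a.snd - lamS‖ ∧
        P.toCone.dLag (v, P.toCone.proj (a.snd + rho • P.toCone.con v)) = 0 ∧
        ‖v - a.fst‖ + ‖P.toCone.proj (a.snd + rho • P.toCone.con v) - a.snd‖ ≤
          C₂ * P.toCone.res a.fst a.snd := by
    have h1 := hbound.and hstat
    rw [← nhdsWithin_univ uS, ← nhdsWithin_prod_eq, eventually_nhdsWithin_iff] at h1
    have h2 : Tendsto (fun a : WithLp 2 (Bilevel.Prim n m r s × Bilevel.Dual m p q r s) =>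
        (a.fst, a.snd)) (𝓝 (Bilevel.pair uS lamS)) (𝓝 (uS, lamS)) :=
      (WithLp.prod_continuous_ofLp 2 _ _).tendsto (Bilevel.pair uS lamS)
    exact (h2.eventually h1).mono fun a ha hp => ha ⟨Set.mem_univ _, hp⟩
  obtain ⟨δe, hδe, hev⟩ := Metric.nhds_basis_closedBall.eventually_iff.1 hev
  set zS := Bilevel.pair uS lamS with hzS
  set δ := min δL (min δd δe) with hδ
  have hδ0 : 0 < δ := lt_min hδL (lt_min hδd hδe)
  have hδ_L : Metric.closedBall zS δ ⊆ Metric.closedBall zS δL :=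
    Metric.closedBall_subset_closedBall (min_le_left _ _)
  have hδ_e : Metric.closedBall zS δ ⊆ Metric.closedBall zS δe :=
    Metric.closedBall_subset_closedBall ((min_le_right _ _).trans (min_le_right _ _))
  have hδ_d : ∀ v : Bilevel.Prim n m r s, ‖v - uS‖ ≤ δ →
      DifferentiableAt ℝ P.toCone.obj v ∧ DifferentiableAt ℝ P.toCone.con v := fun v hv =>
    hdiff (by
      rw [Metric.mem_closedBall, dist_eq_norm]
      exact hv.trans ((min_le_right _ _).trans (min_le_left _ _)))
  have hfst : ∀ a ∈ Metric.closedBall zS δ, ‖a.fst - uS‖ ≤ δ := fun a ha => by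
    rw [Metric.mem_closedBall, dist_eq_norm] at ha
    exact (Bilevel.norm_fst_le_norm_pair (a.fst - uS) (a.snd - lamS)).trans ha
  have hsnd : ∀ a ∈ Metric.closedBall zS δ, ‖a.snd - lamS‖ ≤ δ := fun a ha => by
    rw [Metric.mem_closedBall, dist_eq_norm] at ha
    exact (Bilevel.norm_snd_le_norm_pair (a.fst - uS) (a.snd - lamS)).trans ha
  have hdS := hδ_d uS (by simpa using hδ0.le)
  have hσ : ∀ a, 0 ≤ P.pairResidual a := fun a => P.residual_nonneg _ _
  have hσS : P.pairResidual zS = 0 :=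
    Bilevel.Problem.residual_eq_zero hdS.1 hdS.2 hsosc.1
  -- `C₂` refers to the residual `res`, a sum of norms, which is at most twice the Euclidean
  -- residual of the method.
  refine ⟨2 * C₂, by positivity, fun c hc => ?_⟩
  have hc0 : 0 < c := lt_of_lt_of_le (by positivity) hc
  -- The first bound keeps all iterates in the ball of radius `δ`; the second puts the initial
  -- residual where `psi t ≤ t / 4`. The penalty `4 * c` makes the other term of the decrease at
  -- most a quarter of the residual.
  refine ⟨min (δ / (1 + 2 * c * L)) (δ₁ / (2 * L)), by positivity, max rho₀ (4 * c),
    by positivity, ?_⟩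
  set ε := min (δ / (1 + 2 * c * L)) (δ₁ / (2 * L)) with hεdef
  have hε : (1 + 2 * c * L) * ε ≤ δ := by
    have h1 : 0 < 1 + 2 * c * L := by positivity
    calc (1 + 2 * c * L) * ε ≤ (1 + 2 * c * L) * (δ / (1 + 2 * c * L)) :=
          mul_le_mul_of_nonneg_left (min_le_left _ _) h1.le
      _ = δ := mul_div_cancel₀ _ h1.ne'
  have hε' : L * ε < δ₁ := by
    calc L * ε ≤ L * (δ₁ / (2 * L)) := mul_le_mul_of_nonneg_left (min_le_right _ _) hL.le
      _ = δ₁ / 2 := by field_simp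
      _ < δ₁ := half_lt_self hδ₁
  have hlip' : ∀ a ∈ Metric.closedBall zS δ, ∀ b ∈ Metric.closedBall zS δ,
      |P.pairResidual a - P.pairResidual b| ≤ L * ‖a - b‖ := fun a ha b hb =>
    hlip a (hδ_L ha) b (hδ_L hb)
  have hdecrease : ∀ {rho : ℝ} {u lam u' lam'}, max rho₀ (4 * c) ≤ rho →
      lam ∈ Bilevel.polarCone m p q r s →
      P.IsStep c rho (psi (P.residual u lam)) u lam u' lam' →
      Bilevel.pair u' lam' ∈ Metric.closedBall zS δ →
      P.residual u' lam' ≤ psi (P.residual u lam) + c * P.residual u lam / rho := by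
    intro rho u lam u' lam' hrho hlam hst hu'
    have hd := hδ_d u' (hfst (Bilevel.pair u' lam') hu')
    exact hst.residual_le (lt_of_lt_of_le hrho₀ (le_of_max_le_left hrho)) hlam hd.1 hd.2
  refine ⟨fun rho u lam N h0 hlam0 hrho hrun => ?_, ?_⟩
  · have hst : ∀ k < N, P.IsStep c (rho k) (psi (P.residual (u k) (lam k))) (u k) (lam k)
        (u (k + 1)) (lam (k + 1)) := fun k hk => hrun k (by exact_mod_cast hk)
    have hpol : ∀ k ≤ N, lam k ∈ Bilevel.polarCone m p q r s := fun k hk => by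
      rcases k with - | k
      · exact hlam0
      · exact (hst k hk).mem_polarCone
    have hloc := iteration_localized hσ hσS hL.le hlip' hc0 hpsi₁ hε hε'
      (z := fun k => Bilevel.pair (u k) (lam k)) h0 (fun k => le_of_max_le_right (hrho k)) (N := N)
      (fun k hk => (hst k hk).norm_sub_le)
      (fun k hk _ hB => hdecrease (hrho k) (hpol k hk.le) (hst k hk) hB)
    have hNB := (hloc N le_rfl).1
    obtain ⟨v, hv1, hv2, hv3⟩ := (hev (hδ_e hNB) (P.toCone_polar ▸ hpol N le_rfl)).2 (rho N)
      (le_of_max_le_left (hrho N))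
    have hdv := hδ_d v (hv1.trans (hsnd (Bilevel.pair (u N) (lam N)) hNB))
    have hdN := hδ_d (u N) (hfst (Bilevel.pair (u N) (lam N)) hNB)
    have hrN : 0 < rho N := lt_of_lt_of_le hrho₀ (le_of_max_le_left (hrho N))
    rw [P.toCone_proj] at hv2 hv3
    have haug := Bilevel.Problem.hasFDerivAt_augLag hrN hdv.1 hdv.2 (lam N)
    refine ⟨v, _, ⟨haug.differentiableAt, ?_⟩, ?_, rfl⟩
    · rw [Bilevel.Problem.gradient_augLag hrN hdv.1 hdv.2,
        Bilevel.Problem.norm_gradLag hdv.1 hdv.2]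
      -- An exact stationary point meets every nonnegative tolerance, including `psi 0`.
      refine (le_of_eq ?_).trans (hpsi_nonneg _ (P.residual_nonneg _ _))
      rw [norm_eq_zero]
      exact hv2
    · refine (Bilevel.norm_pair_le _ _).trans (hv3.trans ?_)
      have h1 := Bilevel.Problem.res_le_residual hdN.1 hdN.2 (lam N)
      have h2 := mul_le_mul_of_nonneg_left h1 hC₂.le
      have h3 := mul_le_mul_of_nonneg_right hc (P.residual_nonneg (u N) (lam N))
      exact h2.trans (by linarith)
  have hconv : ∀ (rho : ℕ → ℝ) (u : ℕ → Bilevel.Prim n m r s) (lam : ℕ → Bilevel.Dual m p q r s),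
      ‖Bilevel.pair (u 0 - uS) (lam 0 - lamS)‖ ≤ ε →
      lam 0 ∈ Bilevel.polarCone m p q r s → (∀ k, max rho₀ (4 * c) ≤ rho k) →
      P.IsRun ⊤ psi c rho u lam → ∃ lamBar ∈ P.multipliers uS,
        Tendsto (fun k => Bilevel.pair (u k) (lam k)) atTop (𝓝 (Bilevel.pair uS lamBar)) ∧
        ∀ t > 0, (∀ᶠ k in atTop, 4 * c ^ 2 * L / t ≤ rho k) → ∀ᶠ k in atTop,
          ‖Bilevel.pair (u (k + 1)) (lam (k + 1)) - Bilevel.pair uS lamBar‖ ≤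
            t * ‖Bilevel.pair (u k) (lam k) - Bilevel.pair uS lamBar‖ := by
    intro rho u lam h0 hlam0 hrho hrun
    have hst : ∀ k, P.IsStep c (rho k) (psi (P.residual (u k) (lam k))) (u k) (lam k)
        (u (k + 1)) (lam (k + 1)) := fun k => hrun k (WithTop.coe_lt_top _)
    have hpol : ∀ k, lam k ∈ Bilevel.polarCone m p q r s := fun k => by
      rcases k with - | k
      · exact hlam0
      · exact (hst k).mem_polarCone
    obtain ⟨a, haB, hσa, ha, hrate⟩ := iteration_converges hσ hσS hL hlip' hc0 hpsi hpsi₁ hε hε'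
      (z := fun k => Bilevel.pair (u k) (lam k)) h0 (fun k => le_of_max_le_right (hrho k))
      (fun k => (hst k).norm_sub_le)
      (fun k _ hB => hdecrease (hrho k) (hpol k) (hst k) hB)
    have hsndlim : Tendsto lam atTop (𝓝 a.snd) :=
      ((WithLp.prod_continuous_ofLp 2 _ _).snd.tendsto a).comp ha
    have hapol : a.snd ∈ P.toCone.polar :=
      P.toCone.isClosed_polar.mem_of_tendsto hsndlim
        (Eventually.of_forall fun k => P.toCone_polar ▸ hpol k)
    have hda := hδ_d a.fst (hfst a haB)
    have hres : P.toCone.res a.fst a.snd = 0 := by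
      refine le_antisymm ?_ (P.toCone.res_nonneg _ _)
      have := Bilevel.Problem.res_le_residual hda.1 hda.2 a.snd
      have h2 : P.residual a.fst a.snd = 0 := hσa
      rwa [h2, mul_zero] at this
    -- The error bound at the limit, where the residual is zero, makes both distances vanish.
    obtain ⟨⟨h1, nu, hnu, -, h2⟩, -⟩ := hev (hδ_e haB) hapol
    rw [hres, mul_zero] at h1 h2
    have h3 : a.fst = uS := sub_eq_zero.1 (norm_eq_zero.1 (le_antisymm h1 (norm_nonneg _)))
    have h4 : a.snd = nu := sub_eq_zero.1 (norm_eq_zero.1 (le_antisymm h2 (norm_nonneg _)))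
    have h5 : a = Bilevel.pair uS a.snd := by rw [← h3]; rfl
    refine ⟨a.snd, ?_, ?_, ?_⟩
    · rw [Bilevel.Problem.mem_toCone_multipliers hdS.1 hdS.2, h4]
      exact ⟨hnu, hcone.feasible⟩
    · rwa [← h5]
    · rwa [← h5]
  -- The threshold `4 * c ^ 2 * L / t` involves no data of the run, so it is uniform as required for
  -- the linear rate. When `rho` tends to infinity it is eventually exceeded for every `t`, which is
  -- the superlinear rate.
  refine ⟨fun rho u lam h0 hlam0 hrho hrun => ?_, fun t ht _ => ⟨4 * c ^ 2 * L / t,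
    fun rho u lam h0 hlam0 hrho hrhoT hrun => ?_⟩⟩
  · obtain ⟨lamBar, hmem, hlim, hrate⟩ := hconv rho u lam h0 hlam0 hrho hrun
    refine ⟨lamBar, hmem, hlim, fun hinf => ⟨hlim, ?_⟩⟩
    rw [Asymptotics.isLittleO_iff]
    exact fun t ht => hrate t ht (hinf.eventually_ge_atTop _)
  · obtain ⟨lamBar, hmem, hlim, hrate⟩ := hconv rho u lam h0 hlam0 hrho hrun
    exact ⟨lamBar, hmem, hlim, hrate t ht (Eventually.of_forall hrhoT)⟩
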